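/- Let $m$ be Lebesgue measure on $[0,1]$ and let $\Lambda=(\lambda_n)_{n\ge 1}$ be a lacunary sequence of positive real numbers, i.e. there is $\gamma>1$ with $\lambda_{n+1}/\lambda_n\ge\gamma$ for all $n\ge1$. For $1\le p<\infty$ let the Müntz space $M^p_\Lambda$ be the closed linear span of the monomials $x^{\lambda_n}$, $n\ge1$, in $L^p([0,1],m)$ (real or complex scalars), and call the elements of $\operatorname{span}\{x^{\lambda_n}:n\ge 1\}$ Müntz polynomials. For $0<\varepsilon<1$ put $J_\varepsilon=[1-\varepsilon,1]$. Let $\mu$ be a finite positive Borel measure on $[0,1]$. The measure $\mu$ is called sublinear if there is $C>0$ with $\mu(J_\varepsilon)\le C\varepsilon$ for all $0<\varepsilon<1$, and vanishing sublinear if $\lim_{\varepsilon\to0^+}\mu(J_\varepsilon)/\varepsilon=0$. It is called $\Lambda_p$-embedding if there is $C>0$ with $\|g\|_{L^p(\mu)}\le C\|g\|_{L^p(m)}$ for every Müntz polynomial $g$; in that case $i^p_\mu:M^p_\Lambda\to L^p(\mu)$ denotes the embedding operator, that is, the unique bounded linear operator that maps each Müntz polynomial to itself. Then: (i) every sublinear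 measure $\mu$ is $\Lambda_p$-embedding for all $1\le p\le2$; (ii) for every vanishing sublinear measure $\mu$ and all $1\le p\le 2$, $\mu$ is $\Lambda_p$-embedding and the embedding $i^p_\mu:M^p_\Lambda\to L^p(\mu)$ is compact. -/

import Mathlib

open MeasureTheory Filter Topology
open scoped ENNReal NNReal unitInterval

noncomputable section

namespace Muntz

/-- Lebesgue measure on `[0,1]`. -/
def leb : Measure I := volume

instance : IsProbabilityMeasure leb := inferInstanceAs (IsProbabilityMeasure (volume : Measure I))

/-- The monomial `x ↦ x ^ a` on `[0,1]`, for a real exponent `a ≥ 0`. -/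
def monomial (𝕜 : Type*) [RCLike 𝕜] (a : ℝ≥0) : C(I, 𝕜) where
  toFun x := (((x : ℝ) ^ (a : ℝ) : ℝ) : 𝕜)
  continuous_toFun := RCLike.continuous_ofReal.comp
    ((Real.continuous_rpow_const a.coe_nonneg).comp continuous_subtype_val)

/-- The Müntz polynomial `∑ c n * x ^ (Λ n)` with the (finitely supported) coefficients `c`,
linear in `c`. -/
def polynomial (𝕜 : Type*) [RCLike 𝕜] (Λ : ℕ → ℝ≥0) : (ℕ →₀ 𝕜) →ₗ[𝕜] C(I, 𝕜) :=
  Finsupp.linearCombination 𝕜 fun n => monomial 𝕜 (Λ n)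

theorem polynomial_apply {𝕜 : Type*} [RCLike 𝕜] (Λ : ℕ → ℝ≥0) (c : ℕ →₀ 𝕜) (x : I) :
    polynomial 𝕜 Λ c x = ∑ n ∈ c.support, c n * (((x : ℝ) ^ (Λ n : ℝ) : ℝ) : 𝕜) := by
  simp [polynomial, Finsupp.linearCombination_apply, Finsupp.sum, monomial, ContinuousMap.sum_apply]

/-- The class in `L^p(μ)` of the Müntz polynomial with coefficients `c`, linear in `c`. -/
def polynomialLp (𝕜 : Type*) [RCLike 𝕜] (Λ : ℕ → ℝ≥0) (p : ℝ≥0∞) [Fact (1 ≤ p)]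
    (μ : Measure I) [IsFiniteMeasure μ] : (ℕ →₀ 𝕜) →ₗ[𝕜] Lp 𝕜 p μ :=
  (ContinuousMap.toLp p μ 𝕜).toLinearMap ∘ₗ polynomial 𝕜 Λ

/-- The Müntz space `M^p_Λ`: the closure in `L^p([0,1])` (Lebesgue measure) of the Müntz
polynomials. -/
def space (𝕜 : Type*) [RCLike 𝕜] (Λ : ℕ → ℝ≥0) (p : ℝ≥0∞) [Fact (1 ≤ p)] :
    Submodule 𝕜 (Lp 𝕜 p leb) :=
  (LinearMap.range (polynomialLp 𝕜 Λ p leb)).topologicalClosure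

/-- `Λ` is lacunary: the quotients of consecutive terms are bounded below by some `γ > 1`. -/
def IsLacunary (Λ : ℕ → ℝ≥0) : Prop :=
  ∃ γ : ℝ, 1 < γ ∧ ∀ n, γ ≤ (Λ (n + 1) : ℝ) / (Λ n : ℝ)

/-- The interval `J_ε = [1 - ε, 1]`, as a subset of `[0,1]`. -/
def J (ε : ℝ) : Set I := {x | 1 - ε ≤ (x : ℝ)}

/-- `μ` is sublinear: `μ(J_ε) ≤ C ε` for all `0 < ε < 1`. -/
def IsSublinear (μ : Measure I) : Prop :=
  ∃ C : ℝ, 0 < C ∧ ∀ ε : ℝ, 0 < ε → ε < 1 → μ (J ε) ≤ ENNReal.ofReal (C * ε)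

/-- `μ` is vanishing sublinear: `μ(J_ε) / ε → 0` as `ε → 0+`. -/
def IsVanishingSublinear (μ : Measure I) : Prop :=
  Tendsto (fun ε : ℝ => μ (J ε) / ENNReal.ofReal ε) (𝓝[>] 0) (𝓝 0)

/-- `μ` is `Λ_p`-embedding: `‖g‖_{L^p(μ)} ≤ C ‖g‖_p` for all Müntz polynomials `g`. -/
def IsEmbedding (𝕜 : Type*) [RCLike 𝕜] (Λ : ℕ → ℝ≥0) (p : ℝ≥0∞) [Fact (1 ≤ p)]
    (μ : Measure I) [IsFiniteMeasure μ] : Prop :=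
  ∃ C : ℝ, 0 < C ∧ ∀ c : ℕ →₀ 𝕜, ‖polynomialLp 𝕜 Λ p μ c‖ ≤ C * ‖polynomialLp 𝕜 Λ p leb c‖

/-- A linear map `e : V → E`, with its values regarded as elements of the closure of its range. -/
def toClosure {𝕜 V E : Type*} [RCLike 𝕜] [AddCommGroup V] [Module 𝕜 V]
    [NormedAddCommGroup E] [NormedSpace 𝕜 E] (e : V →ₗ[𝕜] E) :
    V →ₗ[𝕜] (LinearMap.range e).topologicalClosure :=
  e.codRestrict _ fun v => Submodule.le_topologicalClosure _ (LinearMap.mem_range_self e v)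

theorem denseRange_toClosure {𝕜 V E : Type*} [RCLike 𝕜] [AddCommGroup V] [Module 𝕜 V]
    [NormedAddCommGroup E] [NormedSpace 𝕜 E] (e : V →ₗ[𝕜] E) : DenseRange (toClosure e) := by
  rintro ⟨f, hf⟩
  rw [closure_subtype]
  have : Subtype.val '' Set.range (toClosure e) = (LinearMap.range e : Set E) := by
    ext h
    constructor
    · rintro ⟨_, ⟨g, rfl⟩, rfl⟩
      exact ⟨g, rfl⟩
    · rintro ⟨g, rfl⟩
      exact ⟨_, ⟨g, rfl⟩, rfl⟩
  rw [this]
  exact hf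

/-- The continuous extension, to the closure of the range of `e`, of the map `e v ↦ f v`. It is
meaningful when `‖f v‖ ≤ C * ‖e v‖` for some constant `C`. -/
def extendToClosure {𝕜 V E F : Type*} [RCLike 𝕜] [AddCommGroup V] [Module 𝕜 V]
    [NormedAddCommGroup E] [NormedSpace 𝕜 E] [NormedAddCommGroup F] [NormedSpace 𝕜 F]
    [CompleteSpace F] (e : V →ₗ[𝕜] E) (f : V →ₗ[𝕜] F) :
    (LinearMap.range e).topologicalClosure →L[𝕜] F :=
  f.extendOfNorm (toClosure e)

theorem extendToClosure_apply {𝕜 V E F : Type*} [RCLike 𝕜] [AddCommGroup V] [Module 𝕜 V]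
    [NormedAddCommGroup E] [NormedSpace 𝕜 E] [NormedAddCommGroup F] [NormedSpace 𝕜 F]
    [CompleteSpace F] {e : V →ₗ[𝕜] E} {f : V →ₗ[𝕜] F} (h : ∃ C, ∀ v, ‖f v‖ ≤ C * ‖e v‖) (v : V) :
    extendToClosure e f (toClosure e v) = f v :=
  LinearMap.extendOfNorm_eq (denseRange_toClosure e) h v

/-- The embedding operator `i^p_μ : M^p_Λ → L^p(μ)` of a `Λ_p`-embedding measure `μ`: the
extension by continuity of the map that sends a Müntz polynomial to itself. (It is meaningful only
if `μ` is `Λ_p`-embedding.) -/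
def embedding (𝕜 : Type*) [RCLike 𝕜] (Λ : ℕ → ℝ≥0) (p : ℝ≥0∞) [Fact (1 ≤ p)]
    (μ : Measure I) [IsFiniteMeasure μ] : space 𝕜 Λ p →L[𝕜] Lp 𝕜 p μ :=
  extendToClosure (polynomialLp 𝕜 Λ p leb) (polynomialLp 𝕜 Λ p μ)

/-- For a `Λ_p`-embedding measure, the embedding operator sends the class of a Müntz polynomial in
`L^p([0,1])` to its class in `L^p(μ)`. -/
theorem embedding_apply {𝕜 : Type*} [RCLike 𝕜] {Λ : ℕ → ℝ≥0} {p : ℝ≥0∞} [Fact (1 ≤ p)]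
    {μ : Measure I} [IsFiniteMeasure μ] (h : IsEmbedding 𝕜 Λ p μ) (c : ℕ →₀ 𝕜)
    (hc : polynomialLp 𝕜 Λ p leb c ∈ space 𝕜 Λ p) :
    embedding 𝕜 Λ p μ ⟨polynomialLp 𝕜 Λ p leb c, hc⟩ = polynomialLp 𝕜 Λ p μ c := by
  obtain ⟨C, -, hC⟩ := h
  exact extendToClosure_apply ⟨C, hC⟩ c

end Muntz

end

/-!
Write `f = ∑ a n * x ^ (Λ n)` for a Müntz polynomial and `G = ∑ ‖a n‖ * x ^ (Λ n)` for its majorant.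
The theorem rests on the estimate `∫ G ^ p ≤ C * ∫ ‖f‖ ^ p` with respect to Lebesgue measure, for
`1 ≤ p ≤ 2` (`exists_integral_sum_norm_rpow_le`). Since `G` is increasing, its superlevel sets are
intervals `J ε`, so that `∫ G ^ p dμ ≤ K * ∫ G ^ p dm` for every sublinear measure `μ`
(`integral_le_of_monotone`), and the embedding property follows from `‖f‖ ≤ G`.

The estimate passes through the weighted coefficient sum `A = ∑ ‖a n‖ ^ p / Λ n`.

* `∫ G ^ p ≤ C * A` (`integral_sum_rpow_le`): since `p - 1 ≤ 1`, the power `G ^ (p - 1)` is at most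
  `∑ ‖a m‖ ^ (p - 1) * x ^ ((p - 1) * Λ m)`. Integrating `G * G ^ (p - 1)` termwise gives a double
  sum which, by lacunarity, decays geometrically away from the diagonal.
* `A ≤ C * ∫ ‖f‖ ^ p` (`exists_sum_rpow_le_integral`): for a polynomial `P = ∑ w j * u ^ j` without
  constant term, the combination `∑ w j * f (x ^ j)` of dilates of `f` equals
  `∑ a n * P (x ^ (Λ n))`. Take `P = (4 u (1 - u)) ^ N`, which peaks at `u = 1 / 2`. On the interval
  where `x ^ (Λ n)` is slightly below `1 / 2` the `n`-th term dominates, and for large `N` the other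
  terms form a matrix of small norm (`exists_bump`, `sum_rpow_sum_ratio_le`) and are absorbed. These
  intervals are disjoint, have length at least a multiple of `1 / Λ n`, and stay away from `0`,
  where the dilations would be unbounded on `L^p`.

For a vanishing sublinear `μ`, the part of `f` with frequencies `Λ n`, `n ≥ N`, is small in `L^p(μ)`
relative to the norm of `f` (`IsVanishingSublinear.exists_tail_le`): on `J ε` because `μ` is there
dominated by a small multiple of Lebesgue measure on increasing functions, and off `J ε` because the
tail of `G` at `1 - ε` is exponentially smaller than at `1 - ε / 2`. Hence the embedding is a norm
limit of operators of finite rank.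
-/

namespace Muntz

/-! ### Lacunary sequences and almost diagonal sums -/

theorem sum_pow_dist_le {θ : ℝ} (h0 : 0 ≤ θ) (h1 : θ < 1) (s : Finset ℕ) (n : ℕ) :
    ∑ m ∈ s, θ ^ Nat.dist m n ≤ 2 / (1 - θ) := by
  have key : ∀ (t : Finset ℕ) (f : ℕ → ℕ), Set.InjOn f t → ∑ m ∈ t, θ ^ f m ≤ 1 / (1 - θ) := by
    intro t f hf
    rw [← Finset.sum_image (f := fun k => θ ^ k) hf, one_div, ← tsum_geometric_of_lt_one h0 h1]
    exact (summable_geometric_of_lt_one h0 h1).sum_le_tsum _ fun k _ => pow_nonneg h0 k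
  rw [← Finset.sum_filter_add_sum_filter_not s (fun m => m ≤ n)]
  have e : 2 / (1 - θ) = 1 / (1 - θ) + 1 / (1 - θ) := by ring
  rw [e]
  refine add_le_add (key _ _ ?_) (key _ _ ?_) <;>
  · intro a ha b hb hab
    simp [Nat.dist] at ha hb hab
    omega

/-- The ratio of the smaller to the larger of the exponents `l m` and `l n`; for a lacunary
sequence it decays geometrically away from the diagonal. -/
noncomputable def ratio (l : ℕ → ℝ) (m n : ℕ) : ℝ := min (l m / l n) (l n / l m)

section
variable {l : ℕ → ℝ} {g : ℝ}

theorem ratio_comm (l : ℕ → ℝ) (m n : ℕ) : ratio l m n = ratio l n m := min_comm _ _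

theorem ratio_pos (hl : ∀ n, 0 < l n) (m n : ℕ) : 0 < ratio l m n :=
  lt_min (div_pos (hl _) (hl _)) (div_pos (hl _) (hl _))

theorem ratio_le_one (hl : ∀ n, 0 < l n) (m n : ℕ) : ratio l m n ≤ 1 := by
  rcases le_total (l m) (l n) with h | h
  · exact (min_le_left _ _).trans ((div_le_one (hl n)).2 h)
  · exact (min_le_right _ _).trans ((div_le_one (hl m)).2 h)

theorem pow_mul_le_of_lacunary (hg : 1 < g) (hlac : ∀ n, g * l n ≤ l (n + 1)) (n k : ℕ) :
    g ^ k * l n ≤ l (n + k) := by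
  induction k with
  | zero => simp
  | succ k ih =>
    calc g ^ (k + 1) * l n = g * (g ^ k * l n) := by ring
      _ ≤ g * l (n + k) := by gcongr
      _ ≤ l (n + (k + 1)) := hlac _

theorem ratio_le_pow_dist (hl : ∀ n, 0 < l n) (hg : 1 < g) (hlac : ∀ n, g * l n ≤ l (n + 1))
    (m n : ℕ) : ratio l m n ≤ g⁻¹ ^ Nat.dist m n := by
  wlog h : m ≤ n generalizing m n
  · rw [ratio_comm, Nat.dist_comm]
    exact this _ _ (le_of_not_ge h)
  obtain ⟨k, rfl⟩ := Nat.exists_eq_add_of_le h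
  have hd : Nat.dist m (m + k) = k := by simp [Nat.dist]
  rw [hd, inv_pow]
  refine (min_le_left _ _).trans ?_
  rw [div_le_iff₀ (hl _), inv_mul_eq_div, le_div_iff₀ (by positivity), mul_comm]
  exact pow_mul_le_of_lacunary hg hlac m k

theorem mul_le_of_lt (hl : ∀ n, 0 < l n) (hg : 1 < g) (hlac : ∀ n, g * l n ≤ l (n + 1))
    {m n : ℕ} (h : m < n) : g * l m ≤ l n := by
  obtain ⟨k, rfl⟩ := Nat.exists_eq_add_of_lt h
  refine le_trans ?_ (pow_mul_le_of_lacunary hg hlac m (k + 1))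
  have : g ≤ g ^ (k + 1) := le_self_pow₀ hg.le (by omega)
  exact mul_le_mul_of_nonneg_right this (hl m).le

theorem sum_ratio_rpow_le (hl : ∀ n, 0 < l n) (hg : 1 < g) (hlac : ∀ n, g * l n ≤ l (n + 1))
    {δ : ℝ} (hδ : 0 < δ) (s : Finset ℕ) (n : ℕ) :
    ∑ m ∈ s, ratio l m n ^ δ ≤ 2 / (1 - g⁻¹ ^ δ) := by
  have g0 : 0 < g := by linarith
  refine le_trans (Finset.sum_le_sum fun m _ => ?_) (sum_pow_dist_le (by positivity)
    (Real.rpow_lt_one (by positivity) (inv_lt_one_of_one_lt₀ hg) hδ) s n)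
  calc ratio l m n ^ δ ≤ (g⁻¹ ^ Nat.dist m n) ^ δ :=
        Real.rpow_le_rpow (ratio_pos hl m n).le (ratio_le_pow_dist hl hg hlac m n) hδ.le
    _ = (g⁻¹ ^ δ) ^ Nat.dist m n := by
        rw [← Real.rpow_natCast, ← Real.rpow_natCast, ← Real.rpow_mul (by positivity),
          ← Real.rpow_mul (by positivity), mul_comm]

/-! ### The upper estimate -/

theorem rpow_sum_le_sum_rpow {ι : Type*} (s : Finset ι) {f : ι → ℝ} (hf : ∀ i, 0 ≤ f i) {q : ℝ}
    (h0 : 0 < q) (h1 : q ≤ 1) : (∑ i ∈ s, f i) ^ q ≤ ∑ i ∈ s, f i ^ q := by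
  classical
  induction s using Finset.induction_on with
  | empty => simp [Real.zero_rpow h0.ne']
  | insert i s hi ih =>
    rw [Finset.sum_insert hi, Finset.sum_insert hi]
    exact (Real.rpow_add_le_add_rpow (hf i) (Finset.sum_nonneg fun j _ => hf j) h0.le h1).trans
      (by gcongr)

theorem continuous_sum_mul_rpow {𝕜 : Type*} [RCLike 𝕜] (hl : ∀ n, 0 < l n) (s : Finset ℕ)
    (a : ℕ → 𝕜) : Continuous fun x : ℝ => ∑ n ∈ s, a n * ((x ^ l n : ℝ) : 𝕜) :=
  continuous_finsetSum _ fun n _ => continuous_const.mul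
    (RCLike.continuous_ofReal.comp (Real.continuous_rpow_const (hl n).le))

theorem continuous_sum_mul_rpow_real (hl : ∀ n, 0 < l n) (s : Finset ℕ)
    (a : ℕ → ℝ) : Continuous fun x : ℝ => ∑ n ∈ s, a n * x ^ l n :=
  continuous_sum_mul_rpow (𝕜 := ℝ) hl s a

theorem integral_zero_one_rpow {r : ℝ} (hr : 0 ≤ r) : ∫ x in (0 : ℝ)..1, x ^ r = 1 / (r + 1) := by
  rw [integral_rpow (Or.inl (by linarith)), Real.one_rpow, Real.zero_rpow (by linarith), sub_zero]

/-- A weighted form of Young's inequality. In terms of `B n = b n / l n ^ (1 / p)`, the left side is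
`B n * B m ^ (p - 1)` times a coefficient which is at most a power of `ratio l m n`, up to a factor
`(p - 1)⁻¹`; for a lacunary sequence these coefficients therefore decay geometrically away from the
diagonal. -/
theorem mul_rpow_div_le (hl : ∀ n, 0 < l n) {p : ℝ} (hp1 : 1 < p) (hp2 : p ≤ 2) {b : ℕ → ℝ}
    (hb : ∀ n, 0 ≤ b n) (m n : ℕ) :
    b n * b m ^ (p - 1) / (l n + (p - 1) * l m + 1) ≤
      (p - 1)⁻¹ * ratio l m n ^ ((p - 1) / p) * (b n ^ p / l n + b m ^ p / l m) := by
  have hq : 0 < p - 1 := by linarith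
  have hp : 0 < p := by linarith
  set B : ℕ → ℝ := fun k => b k / l k ^ p⁻¹ with hB
  have hBn : ∀ k, 0 ≤ B k := fun k => div_nonneg (hb k) (Real.rpow_nonneg (hl k).le _)
  have hBp : ∀ k, B k ^ p = b k ^ p / l k := fun k => by
    rw [hB]
    simp only
    rw [Real.div_rpow (hb k) (Real.rpow_nonneg (hl k).le _), ← Real.rpow_mul (hl k).le,
      inv_mul_cancel₀ hp.ne', Real.rpow_one]
  have hbB : ∀ k, b k = l k ^ p⁻¹ * B k := fun k => by
    rw [hB]
    simp only
    rw [mul_div_cancel₀ _ (Real.rpow_pos_of_pos (hl k) _).ne']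
  have hsplit : ∀ y : ℝ, 0 ≤ y → y * y ^ (p - 1) = y ^ p := fun y hy => by
    rw [← Real.rpow_one_add' hy (by linarith)]; congr 1; ring
  have hyoung : B n * B m ^ (p - 1) ≤ B n ^ p + B m ^ p := by
    rcases le_total (B n) (B m) with h | h
    · calc B n * B m ^ (p - 1) ≤ B m * B m ^ (p - 1) :=
            mul_le_mul_of_nonneg_right h (Real.rpow_nonneg (hBn m) _)
        _ = B m ^ p := hsplit _ (hBn m)
        _ ≤ _ := le_add_of_nonneg_left (Real.rpow_nonneg (hBn n) _)
    · calc B n * B m ^ (p - 1) ≤ B n * B n ^ (p - 1) :=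
            mul_le_mul_of_nonneg_left (Real.rpow_le_rpow (hBn m) h hq.le) (hBn n)
        _ = B n ^ p := hsplit _ (hBn n)
        _ ≤ _ := le_add_of_nonneg_right (Real.rpow_nonneg (hBn m) _)
  have hinv : p⁻¹ + (p - 1) / p = 1 := by field_simp; ring
  have hker : l n ^ p⁻¹ * l m ^ ((p - 1) / p) / (l n + (p - 1) * l m + 1) ≤
      (p - 1)⁻¹ * ratio l m n ^ ((p - 1) / p) := by
    have hn := hl n
    have hm := hl m
    have hden : 0 < l n + (p - 1) * l m + 1 := by positivity
    rw [div_le_iff₀ hden]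
    have hmono : ∀ M : ℝ, 0 ≤ M → (p - 1) * M ≤ l n + (p - 1) * l m + 1 →
        ratio l m n ^ ((p - 1) / p) * M ≤
        (p - 1)⁻¹ * ratio l m n ^ ((p - 1) / p) * (l n + (p - 1) * l m + 1) := by
      intro M _ h
      have : 0 ≤ ratio l m n ^ ((p - 1) / p) := Real.rpow_nonneg (ratio_pos hl m n).le _
      calc ratio l m n ^ ((p - 1) / p) * M
          = (p - 1)⁻¹ * ratio l m n ^ ((p - 1) / p) * ((p - 1) * M) := by field_simp
        _ ≤ _ := by gcongr
    rcases le_total (l m) (l n) with h | h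
    · refine le_trans ?_ (hmono (l n) hn.le (by nlinarith))
      have hr : ratio l m n = l m / l n := min_eq_left
        (((div_le_one hn).2 h).trans ((one_le_div hm).2 h))
      rw [hr, Real.div_rpow hm.le hn.le]
      have : l n = l n ^ p⁻¹ * l n ^ ((p - 1) / p) := by
        rw [← Real.rpow_add hn, hinv, Real.rpow_one]
      have h2 : 0 < l n ^ ((p - 1) / p) := Real.rpow_pos_of_pos hn _
      apply le_of_eq
      calc l n ^ p⁻¹ * l m ^ ((p - 1) / p)
          = l m ^ ((p - 1) / p) / l n ^ ((p - 1) / p) *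
            (l n ^ p⁻¹ * l n ^ ((p - 1) / p)) := by field_simp
        _ = _ := by rw [← this]
    · refine le_trans ?_ (hmono (l m) hm.le (by nlinarith))
      have hr : ratio l m n = l n / l m := min_eq_right
        (((div_le_one hm).2 h).trans ((one_le_div hn).2 h))
      have hr1 : l n / l m ≤ 1 := (div_le_one hm).2 h
      have hle : (l n / l m) ^ p⁻¹ ≤ (l n / l m) ^ ((p - 1) / p) := by
        apply Real.rpow_le_rpow_of_exponent_ge (div_pos hn hm) hr1
        rw [inv_eq_one_div]
        gcongr
        linarith
      rw [hr]
      have : l m = l m ^ p⁻¹ * l m ^ ((p - 1) / p) := by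
        rw [← Real.rpow_add hm, hinv, Real.rpow_one]
      have h2 : 0 < l m ^ p⁻¹ := Real.rpow_pos_of_pos hm _
      calc l n ^ p⁻¹ * l m ^ ((p - 1) / p)
          = (l n ^ p⁻¹ / l m ^ p⁻¹) * (l m ^ p⁻¹ * l m ^ ((p - 1) / p)) := by field_simp
        _ = (l n / l m) ^ p⁻¹ * l m := by rw [← this, Real.div_rpow hn.le hm.le]
        _ ≤ _ := by gcongr
  rw [← hBp n, ← hBp m]
  calc b n * b m ^ (p - 1) / (l n + (p - 1) * l m + 1)
      = l n ^ p⁻¹ * l m ^ ((p - 1) / p) / (l n + (p - 1) * l m + 1) *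
          (B n * B m ^ (p - 1)) := by
        have e : b m ^ (p - 1) = l m ^ ((p - 1) / p) * B m ^ (p - 1) := by
          conv_lhs => rw [hbB m]
          rw [Real.mul_rpow (Real.rpow_nonneg (hl m).le _) (hBn m), ← Real.rpow_mul (hl m).le]
          congr 2
          field_simp
        rw [e]
        conv_lhs => rw [hbB n]
        ring
    _ ≤ _ := mul_le_mul hker hyoung
        (mul_nonneg (hBn n) (Real.rpow_nonneg (hBn m) _))
        (mul_nonneg (by positivity) (Real.rpow_nonneg (ratio_pos hl m n).le _))

/-- The `L^p` norm of a polynomial with nonnegative coefficients is controlled by the coefficients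
in `ℓ^p(1 / l n)`. -/
theorem integral_sum_rpow_le (hl : ∀ n, 0 < l n) (hg : 1 < g) (hlac : ∀ n, g * l n ≤ l (n + 1))
    {p : ℝ} (hp1 : 1 ≤ p) (hp2 : p ≤ 2) :
    ∃ C : ℝ, 0 < C ∧ ∀ (s : Finset ℕ) (b : ℕ → ℝ), (∀ n, 0 ≤ b n) →
      ∫ x in (0 : ℝ)..1, (∑ n ∈ s, b n * x ^ l n) ^ p ≤ C * ∑ n ∈ s, b n ^ p / l n := by
  have hint : ∀ r : ℝ, 0 ≤ r → IntervalIntegrable (fun x : ℝ => x ^ r) volume 0 1 :=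
    fun r hr => (Real.continuous_rpow_const hr).intervalIntegrable _ _
  -- The constant of the double-sum argument contains `(p - 1)⁻¹`, so `p = 1` is separate; there the
  -- estimate is termwise.
  rcases hp1.eq_or_lt with rfl | hp
  · refine ⟨1, one_pos, fun s b hb => ?_⟩
    simp only [Real.rpow_one, one_mul]
    rw [intervalIntegral.integral_finsetSum fun n _ => (hint _ (hl n).le).const_mul _]
    refine Finset.sum_le_sum fun n _ => ?_
    rw [intervalIntegral.integral_const_mul, integral_zero_one_rpow (hl n).le, mul_one_div]
    have := hl n
    have := hb n
    gcongr
    linarith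
  have hq : 0 < p - 1 := by linarith
  set H := 2 / (1 - g⁻¹ ^ ((p - 1) / p)) with hH
  have hδ : 0 < (p - 1) / p := by positivity
  have g0 : 0 < g := by linarith
  have hH0 : 0 < H := div_pos two_pos (sub_pos.2
    (Real.rpow_lt_one (by positivity) (inv_lt_one_of_one_lt₀ hg) hδ))
  refine ⟨(p - 1)⁻¹ * (2 * H), by positivity, fun s b hb => ?_⟩
  have hpt : ∀ x ∈ Set.Icc (0 : ℝ) 1, (∑ n ∈ s, b n * x ^ l n) ^ p ≤
      ∑ n ∈ s, ∑ m ∈ s, b n * b m ^ (p - 1) * x ^ (l n + (p - 1) * l m) := by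
    intro x hx
    have hf : ∀ n, 0 ≤ b n * x ^ l n := fun n => mul_nonneg (hb n) (Real.rpow_nonneg hx.1 _)
    have h0 : 0 ≤ ∑ n ∈ s, b n * x ^ l n := Finset.sum_nonneg fun n _ => hf n
    have e : (∑ n ∈ s, b n * x ^ l n) ^ p =
        (∑ n ∈ s, b n * x ^ l n) * (∑ n ∈ s, b n * x ^ l n) ^ (p - 1) := by
      rw [← Real.rpow_one_add' h0 (by linarith)]; congr 1; ring
    rw [e]
    refine (mul_le_mul_of_nonneg_left (rpow_sum_le_sum_rpow s hf hq (by linarith)) h0).trans ?_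
    rw [Finset.sum_mul_sum]
    refine Finset.sum_le_sum fun n _ => Finset.sum_le_sum fun m _ => le_of_eq ?_
    rw [Real.mul_rpow (hb m) (Real.rpow_nonneg hx.1 _), ← Real.rpow_mul hx.1,
      Real.rpow_add_of_nonneg hx.1 (hl n).le (mul_nonneg hq.le (hl m).le), mul_comm (l m)]
    ring
  have hr : ∀ n m, 0 ≤ l n + (p - 1) * l m := fun n m =>
    add_nonneg (hl n).le (mul_nonneg hq.le (hl m).le)
  calc ∫ x in (0 : ℝ)..1, (∑ n ∈ s, b n * x ^ l n) ^ p
      ≤ ∫ x in (0 : ℝ)..1, ∑ n ∈ s, ∑ m ∈ s, b n * b m ^ (p - 1) * x ^ (l n + (p - 1) * l m) := by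
        refine intervalIntegral.integral_mono_on zero_le_one ?_ ?_ hpt
        · exact ((continuous_sum_mul_rpow_real hl s b).rpow_const
            fun _ => Or.inr (by linarith)).intervalIntegrable _ _
        · exact (continuous_finsetSum _ fun n _ => continuous_finsetSum _ fun m _ =>
            continuous_const.mul (Real.continuous_rpow_const (hr n m))).intervalIntegrable _ _
    _ = ∑ n ∈ s, ∑ m ∈ s, b n * b m ^ (p - 1) / (l n + (p - 1) * l m + 1) := by
        have hterm : ∀ n m, Continuous fun x : ℝ =>
            b n * b m ^ (p - 1) * x ^ (l n + (p - 1) * l m) := fun n m =>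
          continuous_const.mul (Real.continuous_rpow_const (hr n m))
        rw [intervalIntegral.integral_finsetSum fun n _ =>
          (continuous_finsetSum s fun m _ => hterm n m).intervalIntegrable _ _]
        refine Finset.sum_congr rfl fun n _ => ?_
        rw [intervalIntegral.integral_finsetSum fun m _ => (hint _ (hr n m)).const_mul _]
        refine Finset.sum_congr rfl fun m _ => ?_
        rw [intervalIntegral.integral_const_mul, integral_zero_one_rpow (hr n m), mul_one_div]
    _ ≤ ∑ n ∈ s, ∑ m ∈ s, (p - 1)⁻¹ * ratio l m n ^ ((p - 1) / p) *
          (b n ^ p / l n + b m ^ p / l m) :=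
        Finset.sum_le_sum fun n _ => Finset.sum_le_sum fun m _ => mul_rpow_div_le hl hp hp2 hb m n
    _ = (p - 1)⁻¹ * (∑ n ∈ s, b n ^ p / l n * ∑ m ∈ s, ratio l m n ^ ((p - 1) / p) +
          ∑ m ∈ s, b m ^ p / l m * ∑ n ∈ s, ratio l n m ^ ((p - 1) / p)) := by
        simp only [mul_add, Finset.sum_add_distrib, Finset.mul_sum]
        congr 1
        · refine Finset.sum_congr rfl fun n _ => Finset.sum_congr rfl fun m _ => by ring
        · rw [Finset.sum_comm]
          refine Finset.sum_congr rfl fun n _ => Finset.sum_congr rfl fun m _ => ?_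
          rw [ratio_comm l m n]
          ring
    _ ≤ (p - 1)⁻¹ * (∑ n ∈ s, b n ^ p / l n * H + ∑ m ∈ s, b m ^ p / l m * H) := by
        gcongr with n _ m _
        · exact div_nonneg (Real.rpow_nonneg (hb n) _) (hl n).le
        · exact sum_ratio_rpow_le hl hg hlac hδ s n
        · exact div_nonneg (Real.rpow_nonneg (hb m) _) (hl m).le
        · exact sum_ratio_rpow_le hl hg hlac hδ s m
    _ = _ := by
        rw [← Finset.sum_mul]
        ring

end

/-! ### The bump `(4 u (1 - u)) ^ N` -/

/-- The polynomial `(4 u (1 - u)) ^ N`, whose values on `[0,1]` concentrate at `u = 1 / 2` as `N`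
grows. -/
noncomputable def bump (N : ℕ) : Polynomial ℝ :=
  (Polynomial.C 4 * Polynomial.X * (1 - Polynomial.X)) ^ N

theorem eval_bump (N : ℕ) (u : ℝ) : (bump N).eval u = (4 * u * (1 - u)) ^ N := by
  simp [bump]

theorem pos_of_mem_support_bump {N : ℕ} (hN : N ≠ 0) {j : ℕ} (hj : j ∈ (bump N).support) :
    1 ≤ j := by
  rcases Nat.eq_zero_or_pos j with rfl | h
  · rw [Polynomial.mem_support_iff, Polynomial.coeff_zero_eq_eval_zero, eval_bump] at hj
    simp [hN] at hj
  · exact h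

theorem half_rpow_le {r : ℝ} (hr : 0 < r) : (1 / 2 : ℝ) ^ r ≤ 2 * r⁻¹ := by
  have h := Real.add_one_le_exp (Real.log 2 * r)
  have hl := Real.log_two_gt_d9
  rw [← Real.rpow_def_of_pos two_pos] at h
  rw [one_div, Real.inv_rpow two_pos.le, ← div_eq_mul_inv, inv_eq_one_div,
    div_le_div_iff₀ (by positivity) hr]
  nlinarith

/-- Away from the diagonal `r = 1`, the factor `4 u (1 - u)` at `u = v ^ r` is bounded away from
`1` and is at most of the order of `min r r⁻¹`, uniformly for `v` slightly below `1 / 2`. -/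
theorem exists_offdiag_bound {g : ℝ} (hg : 1 < g) :
    ∃ q : ℝ, 0 ≤ q ∧ q < 1 ∧ ∀ v r : ℝ, (1 / 2 : ℝ) ^ √g ≤ v → v ≤ 1 / 2 → 0 < r →
      (g ≤ r ∨ r ≤ g⁻¹) → 0 ≤ 4 * v ^ r * (1 - v ^ r) ∧ 4 * v ^ r * (1 - v ^ r) ≤ q ∧
        4 * v ^ r * (1 - v ^ r) ≤ 8 * √g * min r r⁻¹ := by
  have g0 : 0 < g := by linarith
  have hs1 : 1 < √g := by rwa [Real.lt_sqrt zero_le_one, one_pow]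
  have hs0 : 0 < √g := by linarith
  have hss : √g * √g = g := Real.mul_self_sqrt g0.le
  set a := (1 / 2 : ℝ) ^ g with ha
  set c := (1 / 2 : ℝ) ^ (√g)⁻¹ with hc
  have ha2 : a < 1 / 2 := by
    have := Real.rpow_lt_rpow_of_exponent_gt (x := 1 / 2) (by norm_num) (by norm_num) hg
    rwa [Real.rpow_one] at this
  have ha0 : 0 < a := by positivity
  have hc2 : 1 / 2 < c := by
    have := Real.rpow_lt_rpow_of_exponent_gt (x := 1 / 2) (by norm_num) (by norm_num)
      (inv_lt_one_of_one_lt₀ hs1)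
    rwa [Real.rpow_one] at this
  refine ⟨max (4 * a * (1 - a)) (4 * c * (1 - c)), le_max_of_le_left (by nlinarith),
    max_lt ?_ ?_, fun v r hv1 hv2 hr hcase => ?_⟩
  · nlinarith [mul_pos (sub_pos.2 ha2) (sub_pos.2 ha2)]
  · nlinarith [mul_pos (sub_pos.2 hc2) (sub_pos.2 hc2)]
  have hv0 : 0 < v := lt_of_lt_of_le (by positivity) hv1
  have hu0 : 0 < v ^ r := Real.rpow_pos_of_pos hv0 r
  have hu1 : v ^ r ≤ 1 := Real.rpow_le_one hv0.le (by linarith) hr.le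
  set u := v ^ r with hu
  refine ⟨by nlinarith, ?_⟩
  rcases hcase with h | h
  · have hu2 : u ≤ (1 / 2) ^ r := Real.rpow_le_rpow hv0.le hv2 hr.le
    have hua : u ≤ a := hu2.trans
      (Real.rpow_le_rpow_of_exponent_ge (by norm_num) (by norm_num) h)
    refine ⟨le_max_of_le_left (by nlinarith), ?_⟩
    have hmin : min r r⁻¹ = r⁻¹ := min_eq_right
      ((inv_le_one_of_one_le₀ (hg.le.trans h)).trans (hg.le.trans h))
    rw [hmin]
    have h3 := hu2.trans (half_rpow_le hr)
    have h4 : 0 < r⁻¹ := inv_pos.2 hr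
    nlinarith
  · have hr1 : r ≤ 1 := h.trans (inv_le_one_of_one_le₀ hg.le)
    have huc : c ≤ u := by
      calc c ≤ (1 / 2 : ℝ) ^ (√g * r) := by
            apply Real.rpow_le_rpow_of_exponent_ge (by norm_num) (by norm_num)
            rw [inv_eq_one_div, le_div_iff₀ hs0]
            calc √g * r * √g = √g * √g * r := by ring
              _ = g * r := by rw [hss]
              _ ≤ g * g⁻¹ := by gcongr
              _ = 1 := mul_inv_cancel₀ g0.ne'
        _ = ((1 / 2 : ℝ) ^ √g) ^ r := by rw [Real.rpow_mul (by norm_num)]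
        _ ≤ u := Real.rpow_le_rpow (by positivity) hv1 hr.le
    refine ⟨le_max_of_le_right (by nlinarith), ?_⟩
    have hmin : min r r⁻¹ = r := min_eq_left (hr1.trans ((one_le_inv₀ hr).2 hr1))
    rw [hmin]
    have hlogv : -√g ≤ Real.log v := by
      have h1 := Real.log_le_log (by positivity) hv1
      rw [Real.log_rpow (by norm_num), one_div, Real.log_inv] at h1
      have := Real.log_two_lt_d9
      nlinarith
    have hlogu : 1 - u ≤ √g * r := by
      have h1 := Real.one_sub_inv_le_log_of_pos (inv_pos.2 hu0)
      rw [inv_inv, Real.log_inv, hu, Real.log_rpow hv0] at h1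
      nlinarith
    have : 0 < √g * r := by positivity
    nlinarith

/-- For `N` large and `v0` close enough to `1 / 2`, the bump is at least `1 / 2` on `[v0, 1 / 2]`,
while the off-diagonal values `bump N (v ^ r)` are so small that they can be absorbed. -/
theorem exists_bump {g : ℝ} (hg : 1 < g) {H : ℝ} (hH : 0 < H) :
    ∃ (N : ℕ) (κ v0 : ℝ), N ≠ 0 ∧ 0 ≤ κ ∧ κ * H ≤ 1 / 16 ∧ 0 < v0 ∧ v0 < 1 / 2 ∧
      (1 / 2 : ℝ) ^ g < v0 ∧
      (∀ v : ℝ, v0 ≤ v → v ≤ 1 / 2 → 1 / 2 ≤ (bump N).eval v) ∧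
      ∀ v r : ℝ, v0 ≤ v → v ≤ 1 / 2 → 0 < r → (g ≤ r ∨ r ≤ g⁻¹) →
        |(bump N).eval (v ^ r)| ≤ κ * min r r⁻¹ ^ 2 := by
  obtain ⟨q, hq0, hq1, hq⟩ := exists_offdiag_bound hg
  have g0 : 0 < g := by linarith
  have hs1 : 1 < √g := by rwa [Real.lt_sqrt zero_le_one, one_pow]
  have hsg : √g < g := by nlinarith [Real.mul_self_sqrt g0.le]
  obtain ⟨M, hM⟩ := exists_pow_lt_of_lt_one
    (show (0 : ℝ) < 1 / (16 * ((8 * √g) ^ 2 * H)) by positivity) hq1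
  have hcont : ContinuousAt (fun v => (bump (M + 2)).eval v) (1 / 2) :=
    (bump (M + 2)).continuous.continuousAt
  have hev : ∀ᶠ v in 𝓝 (1 / 2 : ℝ), 1 / 2 < (bump (M + 2)).eval v := by
    refine hcont.eventually (lt_mem_nhds ?_)
    simp only [eval_bump]
    norm_num
  obtain ⟨ε, hε, hball⟩ := Metric.eventually_nhds_iff.1 hev
  have hhalf : (1 / 2 : ℝ) ^ √g < 1 / 2 := by
    have := Real.rpow_lt_rpow_of_exponent_gt (x := 1 / 2) (by norm_num) (by norm_num) hs1
    rwa [Real.rpow_one] at this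
  have hgs : (1 / 2 : ℝ) ^ g < (1 / 2 : ℝ) ^ √g :=
    Real.rpow_lt_rpow_of_exponent_gt (by norm_num) (by norm_num) hsg
  set v0 := max ((1 / 2 : ℝ) ^ √g) (1 / 2 - ε / 2) with hv0
  have hv0s : (1 / 2 : ℝ) ^ √g ≤ v0 := le_max_left _ _
  refine ⟨M + 2, (8 * √g) ^ 2 * q ^ M, v0, by omega, by positivity, ?_,
    lt_of_lt_of_le (by positivity) hv0s, max_lt hhalf (by linarith), hgs.trans_le hv0s, ?_, ?_⟩
  · rw [lt_div_iff₀ (by positivity)] at hM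
    nlinarith
  · intro v h1 h2
    refine (hball ?_).le
    have : 1 / 2 - ε / 2 ≤ v := (le_max_right _ _).trans h1
    rw [Real.dist_eq, abs_lt]
    constructor <;> linarith
  · intro v r h1 h2 hr hcase
    obtain ⟨k0, k1, k2⟩ := hq v r (hv0s.trans h1) h2 hr hcase
    rw [eval_bump, abs_of_nonneg (by positivity), pow_add]
    calc _ ≤ q ^ M * (8 * √g * min r r⁻¹) ^ 2 := by gcongr
      _ = _ := by ring

/-! ### Combinations of the dilations `f ↦ f (x ^ j)` -/

section
variable {𝕜 : Type*} [RCLike 𝕜]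

/-- The combination `∑ w j * F (x ^ j)` of dilates of `F`, where `w j` are the coefficients of the
polynomial `P`. It multiplies each `x ^ a` pointwise into `P (x ^ a)`. -/
noncomputable def dilate (P : Polynomial ℝ) (F : ℝ → 𝕜) (x : ℝ) : 𝕜 :=
  ∑ j ∈ P.support, (P.coeff j : 𝕜) * F (x ^ j)

theorem dilate_sum (P : Polynomial ℝ) (l : ℕ → ℝ) (s : Finset ℕ) (a : ℕ → 𝕜) {x : ℝ}
    (hx : 0 ≤ x) :
    dilate P (fun y : ℝ => ∑ n ∈ s, a n * ((y ^ l n : ℝ) : 𝕜)) x =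
      ∑ n ∈ s, a n * ((P.eval (x ^ l n) : ℝ) : 𝕜) := by
  simp only [dilate, Polynomial.eval_eq_sum, Polynomial.sum_def, Finset.mul_sum]
  rw [Finset.sum_comm]
  refine Finset.sum_congr rfl fun n _ => ?_
  rw [RCLike.ofReal_sum, Finset.mul_sum]
  refine Finset.sum_congr rfl fun j _ => ?_
  rw [RCLike.ofReal_mul, ← Real.rpow_natCast_mul hx, mul_comm (j : ℝ), Real.rpow_mul_natCast hx]
  ring

theorem continuous_dilate (P : Polynomial ℝ) {F : ℝ → 𝕜} (hF : Continuous F) :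
    Continuous (dilate P F) :=
  continuous_finsetSum _ fun _ _ => continuous_const.mul (hF.comp (continuous_pow _))

theorem integral_comp_pow_le {F : ℝ → ℝ} (hF : Continuous F) (h0 : ∀ x, 0 ≤ F x) {δ : ℝ}
    (hδ0 : 0 < δ) (hδ1 : δ ≤ 1) {j : ℕ} (hj : 1 ≤ j) :
    ∫ x in δ..1, F (x ^ j) ≤ (δ ^ j)⁻¹ * ∫ x in (0 : ℝ)..1, F x := by
  have hsub := intervalIntegral.integral_comp_mul_deriv (a := δ) (b := 1) (g := F)
    (f := fun x : ℝ => x ^ j) (f' := fun x : ℝ => (j : ℝ) * x ^ (j - 1))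
    (fun x _ => hasDerivAt_pow j x) (by fun_prop) hF
  simp only [Function.comp_apply, one_pow] at hsub
  have hpow : ∀ x ∈ Set.Icc δ 1, δ ^ j ≤ (j : ℝ) * x ^ (j - 1) := fun x hx =>
    calc δ ^ j ≤ δ ^ (j - 1) := pow_le_pow_of_le_one hδ0.le hδ1 (by omega)
      _ ≤ x ^ (j - 1) := by gcongr; exact hx.1
      _ ≤ (j : ℝ) * x ^ (j - 1) := le_mul_of_one_le_left (pow_nonneg (hδ0.le.trans hx.1) _)
          (by exact_mod_cast hj)
  rw [inv_mul_eq_div, le_div_iff₀ (by positivity), ← intervalIntegral.integral_mul_const]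
  calc ∫ x in δ..1, F (x ^ j) * δ ^ j ≤ ∫ x in δ..1, F (x ^ j) * ((j : ℝ) * x ^ (j - 1)) :=
        intervalIntegral.integral_mono_on hδ1 (Continuous.intervalIntegrable (by fun_prop) _ _)
          (Continuous.intervalIntegrable (by fun_prop) _ _)
          fun x hx => mul_le_mul_of_nonneg_left (hpow x hx) (h0 _)
    _ = ∫ x in δ ^ j..1, F x := hsub
    _ ≤ ∫ x in (0 : ℝ)..1, F x :=
        intervalIntegral.integral_mono_interval (by positivity) (pow_le_one₀ hδ0.le hδ1) le_rfl
          (Eventually.of_forall h0) (hF.intervalIntegrable _ _)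

/-- Away from `0` the dilations `x ↦ x ^ j` with `j ≥ 1` are bounded on `L^p`. -/
theorem exists_integral_dilate_le (P : Polynomial ℝ) (hP : ∀ j ∈ P.support, 1 ≤ j) {p δ : ℝ}
    (hp : 1 ≤ p) (hδ0 : 0 < δ) (hδ1 : δ ≤ 1) :
    ∃ K : ℝ, 0 ≤ K ∧ ∀ F : ℝ → 𝕜, Continuous F →
      ∫ x in δ..1, ‖dilate P F x‖ ^ p ≤ K * ∫ x in (0 : ℝ)..1, ‖F x‖ ^ p := by
  refine ⟨(P.support.card : ℝ) ^ (p - 1) * ∑ j ∈ P.support, |P.coeff j| ^ p * (δ ^ j)⁻¹,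
    by positivity, fun F hF => ?_⟩
  have hFp : Continuous fun x => ‖F x‖ ^ p :=
    hF.norm.rpow_const fun _ => Or.inr (by linarith)
  have hFj : ∀ j : ℕ, Continuous fun x => |P.coeff j| ^ p * ‖F (x ^ j)‖ ^ p := fun j =>
    continuous_const.mul (hFp.comp (continuous_pow j))
  calc ∫ x in δ..1, ‖dilate P F x‖ ^ p
      ≤ ∫ x in δ..1, (P.support.card : ℝ) ^ (p - 1) *
          ∑ j ∈ P.support, |P.coeff j| ^ p * ‖F (x ^ j)‖ ^ p := by
        refine intervalIntegral.integral_mono_on hδ1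
          (((continuous_dilate P hF).norm.rpow_const
            fun _ => Or.inr (by linarith)).intervalIntegrable _ _)
          ((continuous_const.mul
            (continuous_finsetSum _ fun j _ => hFj j)).intervalIntegrable _ _) fun x _ => ?_
        calc ‖dilate P F x‖ ^ p ≤ (∑ j ∈ P.support, |P.coeff j| * ‖F (x ^ j)‖) ^ p := by
              refine Real.rpow_le_rpow (norm_nonneg _) ?_ (by linarith)
              refine (norm_sum_le _ _).trans (Finset.sum_le_sum fun j _ => ?_)
              rw [norm_mul, RCLike.norm_ofReal]
          _ ≤ _ := Real.rpow_sum_le_const_mul_sum_rpow_of_nonneg _ hp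
              fun j _ => by positivity
          _ = _ := by
              congr 1
              exact Finset.sum_congr rfl fun j _ => Real.mul_rpow (abs_nonneg _) (norm_nonneg _)
    _ = (P.support.card : ℝ) ^ (p - 1) *
          ∑ j ∈ P.support, |P.coeff j| ^ p * ∫ x in δ..1, ‖F (x ^ j)‖ ^ p := by
        rw [intervalIntegral.integral_const_mul,
          intervalIntegral.integral_finsetSum fun j _ => (hFj j).intervalIntegrable _ _]
        simp only [intervalIntegral.integral_const_mul]
    _ ≤ (P.support.card : ℝ) ^ (p - 1) *
          ∑ j ∈ P.support, |P.coeff j| ^ p * ((δ ^ j)⁻¹ * ∫ x in (0 : ℝ)..1, ‖F x‖ ^ p) := by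
        gcongr with j hj
        exact integral_comp_pow_le hFp (fun x => by positivity) hδ0 hδ1 (hP j hj)
    _ = _ := by
        rw [mul_assoc, Finset.sum_mul]
        simp only [mul_assoc]

end

/-! ### The lower estimate -/

section
variable {𝕜 : Type*} [RCLike 𝕜] {l : ℕ → ℝ} {g : ℝ}

theorem sum_ratio_le (hl : ∀ n, 0 < l n) (hg : 1 < g) (hlac : ∀ n, g * l n ≤ l (n + 1))
    (s : Finset ℕ) (n : ℕ) : ∑ m ∈ s, ratio l m n ≤ 2 / (1 - g⁻¹) := by
  have := sum_ratio_rpow_le hl hg hlac one_pos s n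
  simpa only [Real.rpow_one] using this

theorem ratio_sq_le (hl : ∀ n, 0 < l n) (m n : ℕ) : ratio l m n ^ 2 ≤ ratio l m n := by
  rw [sq]
  exact mul_le_of_le_one_right (ratio_pos hl m n).le (ratio_le_one hl m n)

/-- Schur's test in the weighted space `ℓ^p(1 / l n)` for the matrix `κ * ratio l m n ^ 2`. -/
theorem sum_rpow_sum_ratio_le (hl : ∀ n, 0 < l n) (hg : 1 < g)
    (hlac : ∀ n, g * l n ≤ l (n + 1)) {p : ℝ} (hp1 : 1 ≤ p) {κ : ℝ} (hκ : 0 ≤ κ) (s : Finset ℕ)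
    {b : ℕ → ℝ} (hb : ∀ n, 0 ≤ b n) :
    ∑ n ∈ s, (∑ m ∈ s, κ * ratio l m n ^ 2 * b m) ^ p / l n ≤
      (κ * (2 / (1 - g⁻¹))) ^ p * ∑ m ∈ s, b m ^ p / l m := by
  set H := 2 / (1 - g⁻¹) with hH
  have hp0 : 0 < p := by linarith
  have hH0 : 0 < H := div_pos two_pos (sub_pos.2 (inv_lt_one_of_one_lt₀ hg))
  have hw : ∀ m n, 0 ≤ κ * ratio l m n ^ 2 := fun m n => by positivity
  have hrow : ∀ n, ∑ m ∈ s, κ * ratio l m n ^ 2 ≤ κ * H := fun n => by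
    rw [← Finset.mul_sum]
    gcongr
    exact (Finset.sum_le_sum fun m _ => ratio_sq_le hl m n).trans (sum_ratio_le hl hg hlac s n)
  have hjensen : ∀ n, (∑ m ∈ s, κ * ratio l m n ^ 2 * b m) ^ p ≤
      (κ * H) ^ (p - 1) * ∑ m ∈ s, κ * ratio l m n ^ 2 * b m ^ p := fun n => by
    have hY : 0 ≤ ∑ m ∈ s, κ * ratio l m n ^ 2 * b m ^ p :=
      Finset.sum_nonneg fun m _ => mul_nonneg (hw m n) (Real.rpow_nonneg (hb m) _)
    have hX : 0 ≤ ∑ m ∈ s, κ * ratio l m n ^ 2 := Finset.sum_nonneg fun m _ => hw m n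
    have h := Real.inner_le_weight_mul_Lp_of_nonneg s hp1 (fun m => κ * ratio l m n ^ 2) b
      (fun m => hw m n) hb
    have h2 := Real.rpow_le_rpow (Finset.sum_nonneg fun m _ => mul_nonneg (hw m n) (hb m)) h hp0.le
    refine h2.trans ?_
    rw [Real.mul_rpow (Real.rpow_nonneg hX _) (Real.rpow_nonneg hY _), ← Real.rpow_mul hX,
      ← Real.rpow_mul hY, inv_mul_cancel₀ hp0.ne', Real.rpow_one, sub_mul, one_mul,
      inv_mul_cancel₀ hp0.ne']
    exact mul_le_mul_of_nonneg_right (Real.rpow_le_rpow hX (hrow n) (by linarith)) hY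
  have hcol : ∀ m n, ratio l m n ^ 2 / l n ≤ ratio l n m / l m := fun m n => by
    have h1 : ratio l m n ≤ l n / l m := min_le_right _ _
    have h2 := (ratio_pos hl m n).le
    rw [ratio_comm l n m, div_le_div_iff₀ (hl n) (hl m), sq, mul_assoc]
    exact mul_le_mul_of_nonneg_left ((le_div_iff₀ (hl m)).1 h1) h2
  calc ∑ n ∈ s, (∑ m ∈ s, κ * ratio l m n ^ 2 * b m) ^ p / l n
      ≤ ∑ n ∈ s, (κ * H) ^ (p - 1) * (∑ m ∈ s, κ * ratio l m n ^ 2 * b m ^ p) / l n :=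
        Finset.sum_le_sum fun n _ => div_le_div_of_nonneg_right (hjensen n) (hl n).le
    _ = (κ * H) ^ (p - 1) * κ * ∑ m ∈ s, b m ^ p * ∑ n ∈ s, ratio l m n ^ 2 / l n := by
        simp only [mul_div_assoc, Finset.sum_div, Finset.mul_sum]
        rw [Finset.sum_comm]
        exact Finset.sum_congr rfl fun m _ => Finset.sum_congr rfl fun n _ => by ring
    _ ≤ (κ * H) ^ (p - 1) * κ * ∑ m ∈ s, b m ^ p * (H / l m) := by
        gcongr with m _
        · exact Real.rpow_nonneg (hb m) _
        · calc ∑ n ∈ s, ratio l m n ^ 2 / l n ≤ ∑ n ∈ s, ratio l n m / l m :=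
                Finset.sum_le_sum fun n _ => hcol m n
            _ = (∑ n ∈ s, ratio l n m) / l m := by rw [Finset.sum_div]
            _ ≤ H / l m := div_le_div_of_nonneg_right (sum_ratio_le hl hg hlac s m) (hl m).le
    _ = _ := by
        have e : (κ * H) ^ p = (κ * H) ^ (p - 1) * (κ * H) := by
          rw [← Real.rpow_add_one' (by positivity) (by linarith)]; congr 1; ring
        rw [e]
        simp only [Finset.mul_sum]
        exact Finset.sum_congr rfl fun m _ => by ring

/-- Where `x ^ l n` lies in the window `[v0, 1 / 2]`, the `n`-th coefficient is controlled by the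
dilated polynomial, up to an absorbable contribution of the other coefficients. -/
theorem half_norm_le (hl : ∀ n, 0 < l n) (hg : 1 < g) (hlac : ∀ n, g * l n ≤ l (n + 1))
    {P : Polynomial ℝ} {κ v0 : ℝ} (hv0 : 0 < v0)
    (hdiag : ∀ v : ℝ, v0 ≤ v → v ≤ 1 / 2 → 1 / 2 ≤ P.eval v)
    (hoff : ∀ v r : ℝ, v0 ≤ v → v ≤ 1 / 2 → 0 < r → (g ≤ r ∨ r ≤ g⁻¹) →
        |P.eval (v ^ r)| ≤ κ * min r r⁻¹ ^ 2) (hκ : 0 ≤ κ)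
    (s : Finset ℕ) (a : ℕ → 𝕜) {n : ℕ} (hn : n ∈ s) {x : ℝ} (hx : 0 ≤ x)
    (hx1 : v0 ≤ x ^ l n) (hx2 : x ^ l n ≤ 1 / 2) :
    ‖a n‖ / 2 ≤ ‖dilate P (fun y : ℝ => ∑ m ∈ s, a m * ((y ^ l m : ℝ) : 𝕜)) x‖ +
      ∑ m ∈ s, κ * ratio l m n ^ 2 * ‖a m‖ := by
  classical
  have g0 : 0 < g := by linarith
  rw [dilate_sum P l s a hx, ← Finset.add_sum_erase s _ hn]
  set R := ∑ m ∈ s.erase n, a m * ((P.eval (x ^ l m) : ℝ) : 𝕜) with hR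
  have hRle : ‖R‖ ≤ ∑ m ∈ s, κ * ratio l m n ^ 2 * ‖a m‖ := by
    refine (norm_sum_le _ _).trans ((Finset.sum_le_sum fun m hm => ?_).trans
      (Finset.sum_le_sum_of_subset_of_nonneg (Finset.erase_subset n s)
        fun m _ _ => by positivity))
    rw [norm_mul, RCLike.norm_ofReal, mul_comm]
    refine mul_le_mul_of_nonneg_right ?_ (norm_nonneg _)
    have hxm : x ^ l m = (x ^ l n) ^ (l m / l n) := by
      rw [← Real.rpow_mul hx, mul_div_cancel₀ _ (hl n).ne']
    have hcase : g ≤ l m / l n ∨ l m / l n ≤ g⁻¹ := by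
      rcases lt_or_gt_of_ne (Finset.ne_of_mem_erase hm) with h | h
      · right
        rw [div_le_iff₀ (hl n), inv_mul_eq_div, le_div_iff₀ g0, mul_comm]
        exact mul_le_of_lt hl hg hlac h
      · left
        rw [le_div_iff₀ (hl n)]
        exact mul_le_of_lt hl hg hlac h
    have := hoff (x ^ l n) (l m / l n) hx1 hx2 (div_pos (hl m) (hl n)) hcase
    rwa [← hxm, inv_div] at this
  have hd : ‖a n‖ / 2 ≤ ‖a n * ((P.eval (x ^ l n) : ℝ) : 𝕜)‖ := by
    have h1 := hdiag _ hx1 hx2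
    rw [norm_mul, RCLike.norm_ofReal, abs_of_nonneg (by linarith)]
    nlinarith [norm_nonneg (a n)]
  have htri : ‖a n * ((P.eval (x ^ l n) : ℝ) : 𝕜)‖ ≤
      ‖a n * ((P.eval (x ^ l n) : ℝ) : 𝕜) + R‖ + ‖R‖ := by
    simpa using norm_sub_le (a n * ((P.eval (x ^ l n) : ℝ) : 𝕜) + R) R
  linarith

theorem rpow_le_of_half_le {p : ℝ} (hp1 : 1 ≤ p) (hp2 : p ≤ 2) {u v w : ℝ} (hu : 0 ≤ u)
    (hv : 0 ≤ v) (hw : 0 ≤ w) (h : u / 2 ≤ v + w) : u ^ p / 4 - 2 * w ^ p ≤ 2 * v ^ p := by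
  have h1 : (u / 2) ^ p ≤ 2 * (v ^ p + w ^ p) := by
    refine (Real.rpow_le_rpow (by positivity) h (by linarith)).trans ?_
    refine (show (v + w) ^ p ≤ 2 ^ (p - 1) * (v ^ p + w ^ p) by
      exact_mod_cast NNReal.rpow_add_le_mul_rpow_add_rpow ⟨v, hv⟩ ⟨w, hw⟩ hp1).trans ?_
    refine mul_le_mul_of_nonneg_right ?_ (by positivity)
    have := Real.rpow_le_rpow_of_exponent_le (x := 2) one_le_two (show p - 1 ≤ 1 by linarith)
    rwa [Real.rpow_one] at this
  have h2 : u ^ p / 4 ≤ (u / 2) ^ p := by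
    rw [Real.div_rpow hu two_pos.le]
    have := Real.rpow_le_rpow_of_exponent_le (x := 2) one_le_two hp2
    have h4 : (2 : ℝ) ^ (2 : ℝ) = 4 := by norm_num
    rw [h4] at this
    gcongr
  linarith

/-- The coefficients of a lacunary Müntz polynomial are controlled in `ℓ^p(1 / l n)` by its
`L^p` norm. -/
theorem exists_sum_rpow_le_integral (hl : ∀ n, 0 < l n) (hg : 1 < g)
    (hlac : ∀ n, g * l n ≤ l (n + 1)) {p : ℝ} (hp1 : 1 ≤ p) (hp2 : p ≤ 2) :
    ∃ C : ℝ, 0 ≤ C ∧ ∀ (s : Finset ℕ) (a : ℕ → 𝕜), ∑ n ∈ s, ‖a n‖ ^ p / l n ≤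
      C * ∫ x in (0 : ℝ)..1, ‖∑ n ∈ s, a n * ((x ^ l n : ℝ) : 𝕜)‖ ^ p := by
  have hp0 : 0 < p := by linarith
  set H := 2 / (1 - g⁻¹) with hH
  have hH0 : 0 < H := div_pos two_pos (sub_pos.2 (inv_lt_one_of_one_lt₀ hg))
  obtain ⟨N, κ, v0, hN, hκ0, hκ, hv0, hv1, hgv, hdiag, hoff⟩ := exists_bump hg hH0
  -- `[lo n, hi n]` is the set where `v0 ≤ x ^ l n ≤ 1 / 2`.
  set lo : ℕ → ℝ := fun n => v0 ^ (l n)⁻¹ with hlo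
  set hi : ℕ → ℝ := fun n => (1 / 2 : ℝ) ^ (l n)⁻¹ with hhi
  have hlo0 : ∀ n, 0 < lo n := fun n => Real.rpow_pos_of_pos hv0 _
  have hlohi : ∀ n, lo n ≤ hi n := fun n =>
    Real.rpow_le_rpow hv0.le hv1.le (inv_pos.2 (hl n)).le
  have hhi1 : ∀ n, hi n ≤ 1 := fun n =>
    Real.rpow_le_one (by norm_num) (by norm_num) (inv_pos.2 (hl n)).le
  have hinv : ∀ {y : ℝ} (n : ℕ), 0 ≤ y → (y ^ (l n)⁻¹) ^ l n = y := fun n hy => by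
    rw [← Real.rpow_mul hy, inv_mul_cancel₀ (hl n).ne', Real.rpow_one]
  have hmem1 : ∀ n, ∀ x ∈ Set.Icc (lo n) (hi n), v0 ≤ x ^ l n := fun n x hx => by
    rw [← hinv n hv0.le]
    exact Real.rpow_le_rpow (hlo0 n).le hx.1 (hl n).le
  have hmem2 : ∀ n, ∀ x ∈ Set.Icc (lo n) (hi n), x ^ l n ≤ 1 / 2 := fun n x hx => by
    rw [← hinv (y := 1 / 2) n (by norm_num)]
    exact Real.rpow_le_rpow ((hlo0 n).le.trans hx.1) hx.2 (hl n).le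
  have hdisj : ∀ m n, m < n → Disjoint (Set.Icc (lo m) (hi m)) (Set.Icc (lo n) (hi n)) := by
    intro m n hmn
    rw [Set.disjoint_left]
    intro x hxm hxn
    have hx0 : 0 ≤ x := (hlo0 m).le.trans hxm.1
    have h1 : x ^ l n ≤ (1 / 2 : ℝ) ^ g := by
      calc x ^ l n = (x ^ l m) ^ (l n / l m) := by
            rw [← Real.rpow_mul hx0, mul_div_cancel₀ _ (hl m).ne']
        _ ≤ (1 / 2 : ℝ) ^ (l n / l m) := Real.rpow_le_rpow (Real.rpow_nonneg hx0 _)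
            (hmem2 m x hxm) (div_pos (hl n) (hl m)).le
        _ ≤ (1 / 2 : ℝ) ^ g := by
            apply Real.rpow_le_rpow_of_exponent_ge (by norm_num) (by norm_num)
            rw [le_div_iff₀ (hl m)]
            exact mul_le_of_lt hl hg hlac hmn
    exact absurd (h1.trans_lt hgv) (not_lt.2 (hmem1 n x hxn))
  have hl0 : ∀ n, l 0 ≤ l n := fun n => by
    rcases Nat.eq_zero_or_pos n with rfl | h
    · exact le_rfl
    · exact (le_mul_of_one_le_left (hl 0).le hg.le).trans (mul_le_of_lt hl hg hlac h)
  have hδ : ∀ n, lo 0 ≤ lo n := fun n =>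
    Real.rpow_le_rpow_of_exponent_ge hv0 (by linarith) (inv_anti₀ (hl 0) (hl0 n))
  have hδ1 : lo 0 ≤ 1 := (hlohi 0).trans (hhi1 0)
  set d := Real.log (1 / 2) - Real.log v0 with hd
  have hd0 : 0 < d := sub_pos.2 (Real.log_lt_log hv0 hv1)
  have hlen : ∀ n, lo 0 * d / l n ≤ hi n - lo n := fun n => by
    have h1 : hi n = lo n * Real.exp (d / l n) := by
      rw [hhi, hlo]
      simp only
      rw [Real.rpow_def_of_pos hv0, Real.rpow_def_of_pos (by norm_num), ← Real.exp_add]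
      congr 1
      rw [hd]
      ring
    have h2 := Real.add_one_le_exp (d / l n)
    have h3 : 0 < d / l n := div_pos hd0 (hl n)
    calc lo 0 * d / l n = lo 0 * (d / l n) := by ring
      _ ≤ lo n * (d / l n) := mul_le_mul_of_nonneg_right (hδ n) h3.le
      _ ≤ lo n * (Real.exp (d / l n) - 1) :=
          mul_le_mul_of_nonneg_left (by linarith) (hlo0 n).le
      _ = hi n - lo n := by rw [h1]; ring
  obtain ⟨K, hK0, hK⟩ := exists_integral_dilate_le (𝕜 := 𝕜) (bump N)
    (fun j hj => pos_of_mem_support_bump hN hj) hp1 (hlo0 0) hδ1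
  have hδd : 0 < lo 0 * d := mul_pos (hlo0 0) hd0
  refine ⟨16 / (lo 0 * d) * K, by positivity, fun s a => ?_⟩
  set F : ℝ → 𝕜 := fun x => ∑ n ∈ s, a n * ((x ^ l n : ℝ) : 𝕜) with hF
  have hFc : Continuous F := continuous_sum_mul_rpow hl s a
  set T : ℝ → ℝ := fun x => ‖dilate (bump N) F x‖ ^ p with hT
  have hTc : Continuous T :=
    (continuous_dilate _ hFc).norm.rpow_const fun _ => Or.inr hp0.le
  have hT0 : ∀ x, 0 ≤ T x := fun x => Real.rpow_nonneg (norm_nonneg _) _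
  set S : ℕ → ℝ := fun n => ∑ m ∈ s, κ * ratio l m n ^ 2 * ‖a m‖ with hS
  have hS0 : ∀ n, 0 ≤ S n := fun n => Finset.sum_nonneg fun m _ => by positivity
  -- Averaging the pointwise bound on `‖a n‖` over `[lo n, hi n]`, whose length is at least a
  -- multiple of `1 / l n`.
  have hterm : ∀ n ∈ s, (‖a n‖ ^ p / 4 - 2 * S n ^ p) / l n ≤
      2 / (lo 0 * d) * ∫ x in Set.Icc (lo n) (hi n), T x := by
    intro n hn
    set y := ‖a n‖ ^ p / 4 - 2 * S n ^ p with hy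
    have hI0 : 0 ≤ ∫ x in Set.Icc (lo n) (hi n), T x := integral_nonneg hT0
    rcases le_total y 0 with h | h
    · exact (div_nonpos_of_nonpos_of_nonneg h (hl n).le).trans (by positivity)
    have hpt : ∀ x ∈ Set.Icc (lo n) (hi n), y ≤ 2 * T x := fun x hx =>
      rpow_le_of_half_le hp1 hp2 (norm_nonneg _) (norm_nonneg _) (hS0 n)
        (half_norm_le hl hg hlac hv0 hdiag hoff hκ0 s a hn ((hlo0 n).le.trans hx.1)
          (hmem1 n x hx) (hmem2 n x hx))
    have hint : y * (hi n - lo n) ≤ 2 * ∫ x in Set.Icc (lo n) (hi n), T x := by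
      rw [← integral_const_mul]
      calc y * (hi n - lo n) = ∫ _ in Set.Icc (lo n) (hi n), y := by
            rw [setIntegral_const, Real.volume_real_Icc_of_le (hlohi n), smul_eq_mul, mul_comm]
        _ ≤ _ := setIntegral_mono_on (continuous_const.integrableOn_Icc)
            ((continuous_const.mul hTc).integrableOn_Icc) measurableSet_Icc hpt
    rw [div_mul_eq_mul_div, le_div_iff₀ hδd]
    calc y / l n * (lo 0 * d) = y * (lo 0 * d / l n) := by ring
      _ ≤ y * (hi n - lo n) := mul_le_mul_of_nonneg_left (hlen n) h
      _ ≤ _ := hint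
  have hsum : ∑ n ∈ s, ∫ x in Set.Icc (lo n) (hi n), T x ≤ ∫ x in (lo 0)..1, T x := by
    rw [← integral_biUnion_finset s (fun _ _ => measurableSet_Icc)
      (fun m _ n _ hmn => (lt_or_gt_of_ne hmn).elim (hdisj m n) fun h => (hdisj n m h).symm)
      (fun _ _ => hTc.integrableOn_Icc), intervalIntegral.integral_of_le hδ1,
      ← integral_Icc_eq_integral_Ioc]
    refine setIntegral_mono_set hTc.integrableOn_Icc (Eventually.of_forall hT0)
      (Eventually.of_forall (Set.iUnion₂_subset fun n _ => ?_))
    exact Set.Icc_subset_Icc (hδ n) (hhi1 n)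
  have hschur : ∑ n ∈ s, S n ^ p / l n ≤ 1 / 16 * ∑ n ∈ s, ‖a n‖ ^ p / l n := by
    refine (sum_rpow_sum_ratio_le hl hg hlac hp1 hκ0 s (fun n => norm_nonneg (a n))).trans ?_
    refine mul_le_mul_of_nonneg_right ?_ (Finset.sum_nonneg fun n _ =>
      div_nonneg (by positivity) (hl n).le)
    calc (κ * H) ^ p ≤ (κ * H) ^ (1 : ℝ) := by
          apply Real.rpow_le_rpow_of_exponent_ge' (by positivity) (by linarith) zero_le_one hp1
      _ = κ * H := Real.rpow_one _
      _ ≤ 1 / 16 := hκ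
  have hA : (∑ n ∈ s, ‖a n‖ ^ p / l n) / 4 - 2 * ∑ n ∈ s, S n ^ p / l n ≤
      2 / (lo 0 * d) * ∫ x in (lo 0)..1, T x := by
    calc _ = ∑ n ∈ s, (‖a n‖ ^ p / 4 - 2 * S n ^ p) / l n := by
          rw [Finset.sum_div, Finset.mul_sum, ← Finset.sum_sub_distrib]
          exact Finset.sum_congr rfl fun n _ => by ring
      _ ≤ ∑ n ∈ s, 2 / (lo 0 * d) * ∫ x in Set.Icc (lo n) (hi n), T x :=
          Finset.sum_le_sum hterm
      _ ≤ _ := by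
          rw [← Finset.mul_sum]
          exact mul_le_mul_of_nonneg_left hsum (by positivity)
  have hfin := mul_le_mul_of_nonneg_left (hK F hFc) (show 0 ≤ 2 / (lo 0 * d) by positivity)
  have e : 16 / (lo 0 * d) * K * ∫ x in (0 : ℝ)..1, ‖F x‖ ^ p =
      8 * (2 / (lo 0 * d) * (K * ∫ x in (0 : ℝ)..1, ‖F x‖ ^ p)) := by ring
  rw [e]
  linarith

/-- Replacing the coefficients of a lacunary Müntz polynomial by their absolute values changes its
`L^p` norm at most by a constant factor. -/
theorem exists_integral_sum_norm_rpow_le (𝕜 : Type*) [RCLike 𝕜] (hl : ∀ n, 0 < l n) (hg : 1 < g)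
    (hlac : ∀ n, g * l n ≤ l (n + 1)) {p : ℝ} (hp1 : 1 ≤ p) (hp2 : p ≤ 2) :
    ∃ C : ℝ, 0 < C ∧ ∀ (s : Finset ℕ) (a : ℕ → 𝕜),
      ∫ x in (0 : ℝ)..1, (∑ n ∈ s, ‖a n‖ * x ^ l n) ^ p ≤
      C * ∫ x in (0 : ℝ)..1, ‖∑ n ∈ s, a n * ((x ^ l n : ℝ) : 𝕜)‖ ^ p := by
  obtain ⟨C, hC, h⟩ := integral_sum_rpow_le hl hg hlac hp1 hp2
  obtain ⟨K, hK, h'⟩ := exists_sum_rpow_le_integral (𝕜 := 𝕜) hl hg hlac hp1 hp2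
  refine ⟨C * (K + 1), by positivity, fun s a => ?_⟩
  refine (h s _ fun n => norm_nonneg (a n)).trans ?_
  rw [mul_assoc]
  refine mul_le_mul_of_nonneg_left ((h' s a).trans ?_) hC.le
  refine mul_le_mul_of_nonneg_right (by linarith) ?_
  exact intervalIntegral.integral_nonneg zero_le_one fun x _ => by positivity

end

/-! ### Sublinear measures -/

theorem integral_leb (h : ℝ → ℝ) : ∫ x : I, h x ∂leb = ∫ x in (0 : ℝ)..1, h x := by
  rw [intervalIntegral.integral_of_le zero_le_one, ← integral_Icc_eq_integral_Ioc]
  exact integral_subtype_comap measurableSet_Icc h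

theorem measurableSet_J (ε : ℝ) : MeasurableSet (J ε) :=
  measurableSet_le measurable_const measurable_subtype_coe

/-- A measure with `ν (J ε) ≤ K * ε` is dominated by `K` times Lebesgue measure on increasing
functions, because the superlevel sets of such functions are intervals `J ε`. -/
theorem lintegral_le_of_monotone {ν : Measure I} {K : ℝ} (hK : 0 ≤ K)
    (hν : ∀ ε : ℝ, 0 < ε → ν (J ε) ≤ ENNReal.ofReal (K * ε)) {f : I → ℝ} (hf : Continuous f)
    (hmono : Monotone f) (h0 : ∀ x, 0 ≤ f x) :
    ∫⁻ x, ENNReal.ofReal (f x) ∂ν ≤ ENNReal.ofReal K * ∫⁻ x, ENNReal.ofReal (f x) ∂leb := by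
  -- For `a = 1` the hypothesis does not apply to `J 0`, and `ν {1} = 0` is obtained as a limit.
  have hIci : ∀ a : I, ν (Set.Ici a) ≤ ENNReal.ofReal K * leb (Set.Ici a) := by
    intro a
    have hleb : leb (Set.Ici a) = ENNReal.ofReal (1 - a) := unitInterval.volume_Ici a
    rw [hleb, ← ENNReal.ofReal_mul hK]
    rcases a.2.2.lt_or_eq with h | h
    · refine le_trans (measure_mono fun x hx => ?_) (hν (1 - a) (sub_pos.2 h))
      have : (a : ℝ) ≤ x := hx
      simpa [J] using this
    · have hle : ∀ ε : ℝ, 0 < ε → ν (Set.Ici a) ≤ ENNReal.ofReal (K * ε) := fun ε hε => by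
        refine (measure_mono fun x hx => ?_).trans (hν ε hε)
        have : (a : ℝ) ≤ x := hx
        simp only [J, Set.mem_ofPred_eq]
        linarith
      have ht : Tendsto (fun ε : ℝ => ENNReal.ofReal (K * ε)) (𝓝[>] 0)
          (𝓝 (ENNReal.ofReal (K * (1 - a)))) := by
        rw [h, sub_self]
        exact ((ENNReal.continuous_ofReal.comp (continuous_const_mul K)).tendsto 0).mono_left
          nhdsWithin_le_nhds
      exact ge_of_tendsto ht (eventually_nhdsWithin_of_forall hle)
  rw [lintegral_eq_lintegral_meas_le ν (Eventually.of_forall h0) hf.measurable.aemeasurable,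
    lintegral_eq_lintegral_meas_le leb (Eventually.of_forall h0) hf.measurable.aemeasurable,
    ← lintegral_const_mul' _ _ ENNReal.ofReal_ne_top]
  refine lintegral_mono fun t => ?_
  rcases Set.eq_empty_or_nonempty {x | t ≤ f x} with h | h
  · simp [h]
  obtain ⟨a, ha, hleast⟩ := (isClosed_le continuous_const hf).isCompact.exists_isLeast h
  have : {x | t ≤ f x} = Set.Ici a :=
    Set.Subset.antisymm (fun x hx => hleast hx) fun x hx => le_trans ha (hmono hx)
  simp only [this]
  exact hIci a

theorem integrable_of_continuous {ν : Measure I} [IsFiniteMeasure ν] {f : I → ℝ}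
    (hf : Continuous f) : Integrable f ν :=
  hf.integrable_of_hasCompactSupport (HasCompactSupport.of_compactSpace f)

theorem integral_le_of_monotone {ν : Measure I} [IsFiniteMeasure ν] {K : ℝ} (hK : 0 ≤ K)
    (hν : ∀ ε : ℝ, 0 < ε → ν (J ε) ≤ ENNReal.ofReal (K * ε)) {f : I → ℝ} (hf : Continuous f)
    (hmono : Monotone f) (h0 : ∀ x, 0 ≤ f x) : ∫ x, f x ∂ν ≤ K * ∫ x, f x ∂leb := by
  have h := lintegral_le_of_monotone hK hν hf hmono h0
  rw [← ofReal_integral_eq_lintegral_ofReal (integrable_of_continuous hf)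
      (Eventually.of_forall h0),
    ← ofReal_integral_eq_lintegral_ofReal (integrable_of_continuous hf) (Eventually.of_forall h0),
    ← ENNReal.ofReal_mul hK] at h
  exact (ENNReal.ofReal_le_ofReal_iff (mul_nonneg hK (integral_nonneg h0))).1 h

theorem IsSublinear.exists_bound {μ : Measure I} [IsFiniteMeasure μ] (h : IsSublinear μ) :
    ∃ K : ℝ, 0 ≤ K ∧ ∀ ε : ℝ, 0 < ε → μ (J ε) ≤ ENNReal.ofReal (K * ε) := by
  obtain ⟨C, hC, h⟩ := h
  have hm : 0 ≤ μ.real Set.univ := measureReal_nonneg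
  refine ⟨C + μ.real Set.univ, by positivity, fun ε hε => ?_⟩
  rcases lt_or_ge ε 1 with h1 | h1
  · exact (h ε hε h1).trans (ENNReal.ofReal_le_ofReal (by nlinarith))
  · calc μ (J ε) ≤ μ Set.univ := measure_mono (Set.subset_univ _)
      _ = ENNReal.ofReal (μ.real Set.univ) := (ofReal_measureReal).symm
      _ ≤ _ := ENNReal.ofReal_le_ofReal (by nlinarith)

theorem IsVanishingSublinear.exists_bound {μ : Measure I} (h : IsVanishingSublinear μ) {η : ℝ}
    (hη : 0 < η) :
    ∃ ε₀ : ℝ, 0 < ε₀ ∧ ε₀ < 1 ∧ ∀ ε : ℝ, 0 < ε → ε ≤ ε₀ → μ (J ε) ≤ ENNReal.ofReal (η * ε) := by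
  have hev := h.eventually (gt_mem_nhds (ENNReal.ofReal_pos.2 hη))
  obtain ⟨u, hu, hsub⟩ := mem_nhdsGT_iff_exists_Ioc_subset.1 hev
  have hu0 : 0 < u := hu
  refine ⟨min u (1 / 2), lt_min hu (by norm_num), (min_le_right _ _).trans_lt (by norm_num),
    fun ε hε hle => ?_⟩
  have h1 : μ (J ε) / ENNReal.ofReal ε < ENNReal.ofReal η :=
    hsub ⟨hε, hle.trans (min_le_left _ _)⟩
  have hne : ENNReal.ofReal ε ≠ 0 := (ENNReal.ofReal_pos.2 hε).ne'
  rw [ENNReal.ofReal_mul hη.le]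
  exact (ENNReal.div_le_iff hne ENNReal.ofReal_ne_top).1 h1.le

theorem IsVanishingSublinear.isSublinear {μ : Measure I} [IsFiniteMeasure μ]
    (h : IsVanishingSublinear μ) : IsSublinear μ := by
  obtain ⟨ε₀, h0, -, hb⟩ := h.exists_bound one_pos
  have hm : 0 ≤ μ.real Set.univ := measureReal_nonneg
  refine ⟨1 + μ.real Set.univ / ε₀, by positivity, fun ε hε _ => ?_⟩
  rcases le_total ε ε₀ with h1 | h1
  · refine (hb ε hε h1).trans (ENNReal.ofReal_le_ofReal ?_)
    gcongr
    linarith [div_nonneg hm h0.le]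
  · calc μ (J ε) ≤ μ Set.univ := measure_mono (Set.subset_univ _)
      _ = ENNReal.ofReal (μ.real Set.univ) := (ofReal_measureReal).symm
      _ ≤ _ := by
        refine ENNReal.ofReal_le_ofReal ?_
        calc μ.real Set.univ = μ.real Set.univ / ε₀ * ε₀ := by field_simp
          _ ≤ μ.real Set.univ / ε₀ * ε := by gcongr
          _ ≤ _ := by gcongr; linarith

theorem restrict_J_le {μ : Measure I} {η ε₀ : ℝ} (hη : 0 ≤ η) (h0 : 0 < ε₀)
    (h : ∀ ε : ℝ, 0 < ε → ε ≤ ε₀ → μ (J ε) ≤ ENNReal.ofReal (η * ε)) (ε : ℝ) (hε : 0 < ε) :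
    μ.restrict (J ε₀) (J ε) ≤ ENNReal.ofReal (η * ε) := by
  rw [Measure.restrict_apply (measurableSet_J ε)]
  rcases le_total ε ε₀ with h1 | h1
  · exact (measure_mono Set.inter_subset_left).trans (h ε hε h1)
  · refine (measure_mono Set.inter_subset_right).trans ((h ε₀ h0 le_rfl).trans ?_)
    exact ENNReal.ofReal_le_ofReal (by gcongr)

/-! ### The increasing majorant of a Müntz polynomial -/

section
variable {𝕜 : Type*} [RCLike 𝕜] {Λ : ℕ → ℝ≥0}

/-- The function `∑ ‖c n‖ * x ^ (Λ n)`, an increasing majorant of the Müntz polynomial with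
coefficients `c`. -/
noncomputable def majorant (Λ : ℕ → ℝ≥0) (c : ℕ →₀ 𝕜) (x : I) : ℝ :=
  ∑ n ∈ c.support, ‖c n‖ * (x : ℝ) ^ (Λ n : ℝ)

theorem majorant_nonneg (c : ℕ →₀ 𝕜) (x : I) : 0 ≤ majorant Λ c x :=
  Finset.sum_nonneg fun _ _ => mul_nonneg (norm_nonneg _) (Real.rpow_nonneg x.2.1 _)

theorem monotone_majorant (c : ℕ →₀ 𝕜) : Monotone (majorant Λ c) := fun x _ hxy =>
  Finset.sum_le_sum fun n _ => mul_le_mul_of_nonneg_left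
    (Real.rpow_le_rpow x.2.1 hxy (Λ n).coe_nonneg) (norm_nonneg _)

theorem continuous_majorant (c : ℕ →₀ 𝕜) : Continuous (majorant Λ c) :=
  continuous_finsetSum _ fun n _ => continuous_const.mul
    ((Real.continuous_rpow_const (Λ n).coe_nonneg).comp continuous_subtype_val)

theorem norm_polynomial_le (c : ℕ →₀ 𝕜) (x : I) : ‖polynomial 𝕜 Λ c x‖ ≤ majorant Λ c x := by
  rw [polynomial_apply]
  refine (norm_sum_le _ _).trans (le_of_eq (Finset.sum_congr rfl fun n _ => ?_))
  rw [norm_mul, RCLike.norm_ofReal, abs_of_nonneg (Real.rpow_nonneg x.2.1 _)]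

theorem continuous_majorant_rpow (c : ℕ →₀ 𝕜) {p : ℝ} (hp : 0 ≤ p) :
    Continuous fun x => majorant Λ c x ^ p :=
  (continuous_majorant c).rpow_const fun _ => Or.inr hp

theorem monotone_majorant_rpow (c : ℕ →₀ 𝕜) {p : ℝ} (hp : 0 ≤ p) :
    Monotone fun x => majorant Λ c x ^ p :=
  fun _ _ hxy => Real.rpow_le_rpow (majorant_nonneg c _) (monotone_majorant c hxy) hp

theorem majorant_rpow_nonneg (c : ℕ →₀ 𝕜) (p : ℝ) (x : I) : 0 ≤ majorant Λ c x ^ p :=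
  Real.rpow_nonneg (majorant_nonneg c x) p

theorem norm_polynomialLp_rpow {p : ℝ≥0∞} [Fact (1 ≤ p)] (hp : p ≠ ∞) (μ : Measure I)
    [IsFiniteMeasure μ] (c : ℕ →₀ 𝕜) :
    ‖polynomialLp 𝕜 Λ p μ c‖ ^ p.toReal = ∫ x, ‖polynomial 𝕜 Λ c x‖ ^ p.toReal ∂μ := by
  have hp1 : 1 ≤ p := Fact.out
  have hp0 : p ≠ 0 := (zero_lt_one.trans_le hp1).ne'
  have hpr : 0 < p.toReal := ENNReal.toReal_pos hp0 hp
  have hmem : MemLp (polynomial 𝕜 Λ c) p μ :=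
    (memLp_congr_ae (ContinuousMap.coeFn_toLp (p := p) (𝕜 := 𝕜) μ (polynomial 𝕜 Λ c))).1
      (Lp.memLp _)
  have hnorm : ‖polynomialLp 𝕜 Λ p μ c‖ =
      (∫ x, ‖polynomial 𝕜 Λ c x‖ ^ p.toReal ∂μ) ^ p.toReal⁻¹ := by
    change ‖ContinuousMap.toLp p μ 𝕜 (polynomial 𝕜 Λ c)‖ = _
    rw [Lp.norm_def, eLpNorm_congr_ae (ContinuousMap.coeFn_toLp μ (polynomial 𝕜 Λ c)),
      hmem.eLpNorm_eq_integral_rpow_norm hp0 hp, ENNReal.toReal_ofReal (by positivity)]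
  rw [hnorm, ← Real.rpow_mul (by positivity), inv_mul_cancel₀ hpr.ne', Real.rpow_one]

theorem norm_polynomialLp_rpow_le {p : ℝ≥0∞} [Fact (1 ≤ p)] (hp : p ≠ ∞) (μ : Measure I)
    [IsFiniteMeasure μ] (c : ℕ →₀ 𝕜) :
    ‖polynomialLp 𝕜 Λ p μ c‖ ^ p.toReal ≤ ∫ x, majorant Λ c x ^ p.toReal ∂μ := by
  rw [norm_polynomialLp_rpow hp]
  have hpr : 0 ≤ p.toReal := ENNReal.toReal_nonneg
  refine integral_mono (integrable_of_continuous ?_)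
    (integrable_of_continuous (continuous_majorant_rpow c hpr)) fun x =>
      Real.rpow_le_rpow (norm_nonneg _) (norm_polynomial_le c x) hpr
  exact (polynomial 𝕜 Λ c).continuous.norm.rpow_const fun _ => Or.inr hpr

/-- The norm comparison of `exists_integral_sum_norm_rpow_le` in terms of classes in
`L^p([0,1])`. -/
theorem exists_integral_majorant_le (hpos : ∀ n, 0 < Λ n) (hlac : IsLacunary Λ) {p : ℝ≥0∞}
    [Fact (1 ≤ p)] (hp2 : p ≤ 2) :
    ∃ C : ℝ, 0 < C ∧ ∀ c : ℕ →₀ 𝕜, ∫ x, majorant Λ c x ^ p.toReal ∂leb ≤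
      C * ‖polynomialLp 𝕜 Λ p leb c‖ ^ p.toReal := by
  obtain ⟨γ, hγ, hlac⟩ := hlac
  have hp : p ≠ ∞ := ne_top_of_le_ne_top (by norm_num) hp2
  have hp1 : 1 ≤ p := Fact.out
  have h1 : 1 ≤ p.toReal := by simpa using ENNReal.toReal_mono hp hp1
  have h2 : p.toReal ≤ 2 := by simpa using ENNReal.toReal_mono (by norm_num) hp2
  obtain ⟨C, hC, h⟩ := exists_integral_sum_norm_rpow_le 𝕜 (l := fun n => (Λ n : ℝ))
    (fun n => NNReal.coe_pos.2 (hpos n)) hγ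
    (fun n => (le_div_iff₀ (NNReal.coe_pos.2 (hpos n))).1 (hlac n)) h1 h2
  refine ⟨C, hC, fun c => ?_⟩
  rw [norm_polynomialLp_rpow hp]
  simp only [polynomial_apply, majorant]
  rw [integral_leb fun x => (∑ n ∈ c.support, ‖c n‖ * x ^ (Λ n : ℝ)) ^ p.toReal,
    integral_leb fun x => ‖∑ n ∈ c.support, c n * ((x ^ (Λ n : ℝ) : ℝ) : 𝕜)‖ ^ p.toReal]
  exact h c.support c

theorem le_rpow_inv_mul_of_rpow_le {p a b D : ℝ} (hp : 0 < p) (ha : 0 ≤ a) (hb : 0 ≤ b)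
    (hD : 0 ≤ D) (h : a ^ p ≤ D * b ^ p) : a ≤ D ^ p⁻¹ * b := by
  have := Real.rpow_le_rpow (by positivity) h (inv_pos.2 hp).le
  rwa [← Real.rpow_mul ha, mul_inv_cancel₀ hp.ne', Real.rpow_one, Real.mul_rpow hD (by positivity),
    ← Real.rpow_mul hb, mul_inv_cancel₀ hp.ne', Real.rpow_one] at this

theorem IsSublinear.isEmbedding (hpos : ∀ n, 0 < Λ n) (hlac : IsLacunary Λ) {μ : Measure I}
    [IsFiniteMeasure μ] (hμ : IsSublinear μ) {p : ℝ≥0∞} [Fact (1 ≤ p)] (hp2 : p ≤ 2) :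
    IsEmbedding 𝕜 Λ p μ := by
  have hp : p ≠ ∞ := ne_top_of_le_ne_top (by norm_num) hp2
  have hp1 : 1 ≤ p := Fact.out
  have hpr : 0 < p.toReal := ENNReal.toReal_pos (zero_lt_one.trans_le hp1).ne' hp
  obtain ⟨C, hC, h⟩ := exists_integral_majorant_le (𝕜 := 𝕜) hpos hlac hp2
  obtain ⟨K, hK, hK'⟩ := hμ.exists_bound
  refine ⟨(K * C) ^ p.toReal⁻¹ + 1, by positivity, fun c => ?_⟩
  refine (le_rpow_inv_mul_of_rpow_le hpr (norm_nonneg _) (norm_nonneg _)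
    (mul_nonneg hK hC.le) ?_).trans
      (mul_le_mul_of_nonneg_right (le_add_of_nonneg_right zero_le_one) (norm_nonneg _))
  calc _ ≤ ∫ x, majorant Λ c x ^ p.toReal ∂μ := norm_polynomialLp_rpow_le hp μ c
    _ ≤ K * ∫ x, majorant Λ c x ^ p.toReal ∂leb :=
        integral_le_of_monotone hK hK' (continuous_majorant_rpow c hpr.le)
          (monotone_majorant_rpow c hpr.le) (majorant_rpow_nonneg c _)
    _ ≤ K * (C * ‖polynomialLp 𝕜 Λ p leb c‖ ^ p.toReal) :=
        mul_le_mul_of_nonneg_left (h c) hK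
    _ = _ := by ring

end

/-! ### Approximation by operators of finite rank -/

section
variable {𝕜 : Type*} [RCLike 𝕜] {Λ : ℕ → ℝ≥0}

theorem majorant_filter_le (P : ℕ → Prop) [DecidablePred P] (c : ℕ →₀ 𝕜) (x : I) :
    majorant Λ (c.filter P) x ≤ majorant Λ c x := by
  simp only [majorant, Finsupp.support_filter]
  refine le_trans (le_of_eq (Finset.sum_congr rfl fun n hn => ?_))
    (Finset.sum_le_sum_of_subset_of_nonneg (Finset.filter_subset P c.support)
      fun n _ _ => mul_nonneg (norm_nonneg _) (Real.rpow_nonneg x.2.1 _))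
  rw [Finsupp.filter_apply_pos _ _ (Finset.mem_filter.1 hn).2]

theorem integral_majorant_filter_le (P : ℕ → Prop) [DecidablePred P] (c : ℕ →₀ 𝕜) {p : ℝ}
    (hp : 0 ≤ p) (μ : Measure I) [IsFiniteMeasure μ] :
    ∫ x, majorant Λ (c.filter P) x ^ p ∂μ ≤ ∫ x, majorant Λ c x ^ p ∂μ :=
  integral_mono (integrable_of_continuous (continuous_majorant_rpow _ hp))
    (integrable_of_continuous (continuous_majorant_rpow _ hp)) fun x =>
      Real.rpow_le_rpow (majorant_nonneg _ x) (majorant_filter_le P c x) hp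

theorem majorant_rpow_mul_le (c : ℕ →₀ 𝕜) {p : ℝ} (hp : 0 ≤ p) (y : I) :
    majorant Λ c y ^ p * (1 - y) ≤ ∫ x, majorant Λ c x ^ p ∂leb := by
  have hint : Integrable (fun x => majorant Λ c x ^ p) leb :=
    integrable_of_continuous (continuous_majorant_rpow c hp)
  have hreal : leb.real (Set.Ici y) = 1 - y := by
    have : leb (Set.Ici y) = ENNReal.ofReal (1 - y) := unitInterval.volume_Ici y
    rw [Measure.real, this, ENNReal.toReal_ofReal (sub_nonneg.2 y.2.2)]
  calc majorant Λ c y ^ p * (1 - y) = ∫ _ in Set.Ici y, majorant Λ c y ^ p ∂leb := by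
        rw [setIntegral_const, hreal, smul_eq_mul, mul_comm]
    _ ≤ ∫ x in Set.Ici y, majorant Λ c x ^ p ∂leb :=
        setIntegral_mono_on (integrable_of_continuous continuous_const) hint.integrableOn
          measurableSet_Ici fun x hx => monotone_majorant_rpow c hp hx
    _ ≤ _ := setIntegral_le_integral hint (Eventually.of_forall (majorant_rpow_nonneg c p))

/-- A polynomial whose frequencies are all at least `a` decays at least like `x ^ a` towards `0`. -/
theorem majorant_mul_le {c : ℕ →₀ 𝕜} {a : ℝ} (h : ∀ n ∈ c.support, a ≤ Λ n)
    {q : ℝ} (hq0 : 0 < q) (hq1 : q ≤ 1) {x y : I} (hxy : (x : ℝ) = q * y) :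
    majorant Λ c x ≤ q ^ a * majorant Λ c y := by
  simp only [majorant, Finset.mul_sum]
  refine Finset.sum_le_sum fun n hn => ?_
  rw [hxy, Real.mul_rpow hq0.le y.2.1, mul_left_comm]
  have h1 : q ^ (Λ n : ℝ) ≤ q ^ a := Real.rpow_le_rpow_of_exponent_ge hq0 hq1 (h n hn)
  have h2 : 0 ≤ (y : ℝ) ^ (Λ n : ℝ) := Real.rpow_nonneg y.2.1 _
  gcongr

theorem IsLacunary.tendsto_atTop (hpos : ∀ n, 0 < Λ n) (hlac : IsLacunary Λ) :
    Tendsto (fun n => (Λ n : ℝ)) atTop atTop := by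
  obtain ⟨γ, hγ, hlac⟩ := hlac
  refine tendsto_atTop_mono (fun n => ?_)
    ((tendsto_pow_atTop_atTop_of_one_lt hγ).atTop_mul_const (NNReal.coe_pos.2 (hpos 0)))
  have := pow_mul_le_of_lacunary (l := fun n => (Λ n : ℝ)) hγ
    (fun n => (le_div_iff₀ (NNReal.coe_pos.2 (hpos n))).1 (hlac n)) 0 n
  simpa using this

theorem IsLacunary.monotone (hpos : ∀ n, 0 < Λ n) (hlac : IsLacunary Λ) : Monotone Λ := by
  obtain ⟨γ, hγ, hlac⟩ := hlac
  refine monotone_nat_of_le_succ fun n => ?_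
  have h0 : 0 < (Λ n : ℝ) := NNReal.coe_pos.2 (hpos n)
  have := (le_div_iff₀ h0).1 (hlac n)
  exact NNReal.coe_le_coe.1 ((le_mul_of_one_le_left h0.le hγ.le).trans this)

/-- For a vanishing sublinear measure the high-frequency part of a Müntz polynomial is small in
`L^p(μ)`: near `1` because `μ` is small there compared with Lebesgue measure, and away from `1`
because `x ^ (Λ n)` is small. -/
theorem IsVanishingSublinear.exists_tail_le (hpos : ∀ n, 0 < Λ n) (hlac : IsLacunary Λ)
    {μ : Measure I} [IsFiniteMeasure μ] (hμ : IsVanishingSublinear μ) {p : ℝ} (hp : 1 ≤ p)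
    {η : ℝ} (hη : 0 < η) :
    ∃ N : ℕ, ∀ c : ℕ →₀ 𝕜, ∫ x, majorant Λ (c.filter fun n => ¬ n < N) x ^ p ∂μ ≤
      η * ∫ x, majorant Λ c x ^ p ∂leb := by
  have hp0 : 0 ≤ p := by linarith
  obtain ⟨ε, hε0, hε1, hε⟩ := hμ.exists_bound (half_pos hη)
  -- `x₀ < y₀ < 1` are the points `1 - ε` and `1 - ε / 2`.
  let x₀ : I := ⟨1 - ε, by constructor <;> linarith⟩
  let y₀ : I := ⟨1 - ε / 2, by constructor <;> linarith⟩
  set q : ℝ := (1 - ε) / (1 - ε / 2) with hq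
  have hq0 : 0 < q := div_pos (by linarith) (by linarith)
  have hq1 : q < 1 := (div_lt_one (by linarith)).2 (by linarith)
  have hxy : (x₀ : ℝ) = q * y₀ := by
    change 1 - ε = (1 - ε) / (1 - ε / 2) * (1 - ε / 2)
    rw [div_mul_cancel₀]
    linarith
  have hm : 0 ≤ μ.real Set.univ := measureReal_nonneg
  have hlim : Tendsto (fun n => μ.real Set.univ * (2 / ε) * q ^ (Λ n : ℝ)) atTop (𝓝 0) := by
    have := ((tendsto_rpow_atTop_of_base_lt_one q (by linarith) hq1).comp
      (hlac.tendsto_atTop hpos)).const_mul (μ.real Set.univ * (2 / ε))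
    simpa using this
  obtain ⟨N, hN⟩ := (hlim.eventually (gt_mem_nhds (half_pos hη))).exists
  refine ⟨N, fun c => ?_⟩
  set t := c.filter fun n => ¬ n < N with ht
  have hsupp : ∀ n ∈ t.support, (Λ N : ℝ) ≤ Λ n := fun n hn => by
    rw [ht, Finsupp.support_filter, Finset.mem_filter] at hn
    exact NNReal.coe_le_coe.2 (hlac.monotone hpos (not_lt.1 hn.2))
  have hcont := continuous_majorant_rpow (Λ := Λ) t hp0
  have hint : Integrable (fun x => majorant Λ t x ^ p) μ := integrable_of_continuous hcont
  have hleb : ∫ x, majorant Λ t x ^ p ∂leb ≤ ∫ x, majorant Λ c x ^ p ∂leb :=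
    integral_majorant_filter_le _ c hp0 leb
  have h0 : 0 ≤ ∫ x, majorant Λ t x ^ p ∂leb := integral_nonneg (majorant_rpow_nonneg t p)
  have hnear : ∫ x in J ε, majorant Λ t x ^ p ∂μ ≤ η / 2 * ∫ x, majorant Λ t x ^ p ∂leb :=
    integral_le_of_monotone (half_pos hη).le (restrict_J_le (half_pos hη).le hε0 hε) hcont
      (monotone_majorant_rpow t hp0) (majorant_rpow_nonneg t p)
  have hval : majorant Λ t x₀ ^ p ≤ q ^ (Λ N : ℝ) * (2 / ε * ∫ x, majorant Λ t x ^ p ∂leb) := by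
    have hqN : 0 < q ^ (Λ N : ℝ) := Real.rpow_pos_of_pos hq0 _
    have h1 : majorant Λ t x₀ ≤ q ^ (Λ N : ℝ) * majorant Λ t y₀ :=
      majorant_mul_le hsupp hq0 hq1.le hxy
    have h2 : majorant Λ t y₀ ^ p * (ε / 2) ≤ ∫ x, majorant Λ t x ^ p ∂leb := by
      have := majorant_rpow_mul_le (Λ := Λ) t hp0 y₀
      have e : (1 : ℝ) - y₀ = ε / 2 := by
        change 1 - (1 - ε / 2) = ε / 2
        ring
      rwa [e] at this
    have h3 : majorant Λ t y₀ ^ p ≤ 2 / ε * ∫ x, majorant Λ t x ^ p ∂leb := by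
      rw [div_mul_eq_mul_div, le_div_iff₀ hε0]
      linarith
    have h4 : (q ^ (Λ N : ℝ)) ^ p ≤ q ^ (Λ N : ℝ) := by
      have := Real.rpow_le_rpow_of_exponent_ge hqN
        (Real.rpow_le_one hq0.le hq1.le (Λ N).coe_nonneg) hp
      rwa [Real.rpow_one] at this
    calc majorant Λ t x₀ ^ p ≤ (q ^ (Λ N : ℝ) * majorant Λ t y₀) ^ p :=
          Real.rpow_le_rpow (majorant_nonneg _ _) h1 hp0
      _ = (q ^ (Λ N : ℝ)) ^ p * majorant Λ t y₀ ^ p :=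
          Real.mul_rpow hqN.le (majorant_nonneg _ _)
      _ ≤ _ := mul_le_mul h4 h3 (majorant_rpow_nonneg t p _) hqN.le
  have hfar : ∫ x in (J ε)ᶜ, majorant Λ t x ^ p ∂μ ≤ η / 2 * ∫ x, majorant Λ t x ^ p ∂leb := by
    calc ∫ x in (J ε)ᶜ, majorant Λ t x ^ p ∂μ ≤ ∫ _ in (J ε)ᶜ, majorant Λ t x₀ ^ p ∂μ := by
          refine setIntegral_mono_on hint.integrableOn
            (integrable_of_continuous continuous_const) (measurableSet_J ε).compl fun x hx => ?_
          refine monotone_majorant_rpow t hp0 ?_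
          have : ¬ 1 - ε ≤ (x : ℝ) := hx
          exact (not_le.1 this).le
      _ = μ.real (J ε)ᶜ * majorant Λ t x₀ ^ p := by rw [setIntegral_const, smul_eq_mul]
      _ ≤ μ.real Set.univ * (q ^ (Λ N : ℝ) * (2 / ε * ∫ x, majorant Λ t x ^ p ∂leb)) :=
          mul_le_mul (measureReal_mono (Set.subset_univ _)) hval (majorant_rpow_nonneg t p _) hm
      _ = μ.real Set.univ * (2 / ε) * q ^ (Λ N : ℝ) * ∫ x, majorant Λ t x ^ p ∂leb := by ring
      _ ≤ _ := mul_le_mul_of_nonneg_right hN.le h0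
  rw [← integral_add_compl (measurableSet_J ε) hint]
  calc _ ≤ η * ∫ x, majorant Λ t x ^ p ∂leb := by linarith
    _ ≤ _ := mul_le_mul_of_nonneg_left hleb hη.le

/-- An operator on the closure of the range of `e` may be estimated on the elements `e v` only. -/
theorem norm_apply_le_of_toClosure {V E F : Type*} [AddCommGroup V] [Module 𝕜 V]
    [NormedAddCommGroup E] [NormedSpace 𝕜 E] [NormedAddCommGroup F] [NormedSpace 𝕜 F]
    {e : V →ₗ[𝕜] E} (T : (LinearMap.range e).topologicalClosure →L[𝕜] F) {δ : ℝ}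
    (h : ∀ v, ‖T (toClosure e v)‖ ≤ δ * ‖e v‖)
    (u : (LinearMap.range e).topologicalClosure) : ‖T u‖ ≤ δ * ‖u‖ :=
  (denseRange_toClosure e).induction_on (p := fun u => ‖T u‖ ≤ δ * ‖u‖) u
    (isClosed_le (by fun_prop) (by fun_prop)) h

theorem isCompactOperator_of_finiteDimensional {E F : Type*} [NormedAddCommGroup E]
    [NormedSpace 𝕜 E] [NormedAddCommGroup F] [NormedSpace 𝕜 F] [FiniteDimensional 𝕜 F]
    (T : E →L[𝕜] F) : IsCompactOperator T :=
  ((isCompactOperator_id_iff_finiteDimensional (𝕜 := 𝕜) (E := F)).2 inferInstance).comp_clm T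

theorem isCompactOperator_of_approx {E F : Type*} [NormedAddCommGroup E] [NormedSpace 𝕜 E]
    [NormedAddCommGroup F] [NormedSpace 𝕜 F] [CompleteSpace F] {T : E →L[𝕜] F}
    (h : ∀ δ : ℝ, 0 < δ → ∃ G : E →L[𝕜] F, IsCompactOperator G ∧ ‖T - G‖ ≤ δ) :
    IsCompactOperator T := by
  choose G hG hTG using fun n : ℕ => h (1 / ((n : ℝ) + 1)) (by positivity)
  refine isCompactOperator_of_tendsto (l := atTop) (F := G) ?_ (Eventually.of_forall hG)
  rw [tendsto_iff_norm_sub_tendsto_zero]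
  refine squeeze_zero (fun _ => norm_nonneg _) (fun n => ?_)
    tendsto_one_div_add_atTop_nhds_zero_nat
  rw [norm_sub_rev]
  exact hTG n

/-- The extension of `f` to the closure of the range of `e` is compact if `f` can be approximated,
relative to the norm of `e`, by `e`-bounded maps of finite rank. -/
theorem isCompactOperator_extendToClosure {V E F : Type*} [AddCommGroup V] [Module 𝕜 V]
    [NormedAddCommGroup E] [NormedSpace 𝕜 E] [NormedAddCommGroup F] [NormedSpace 𝕜 F]
    [CompleteSpace F] {e : V →ₗ[𝕜] E} {f : V →ₗ[𝕜] F} (hf : ∃ C, ∀ v, ‖f v‖ ≤ C * ‖e v‖)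
    (h : ∀ δ : ℝ, 0 < δ → ∃ (W : Submodule 𝕜 F) (_ : FiniteDimensional 𝕜 W) (r : V →ₗ[𝕜] W),
      (∃ B, ∀ v, ‖r v‖ ≤ B * ‖e v‖) ∧ ∀ v, ‖f v - r v‖ ≤ δ * ‖e v‖) :
    IsCompactOperator (extendToClosure e f) := by
  refine isCompactOperator_of_approx fun δ hδ => ?_
  obtain ⟨W, hW, r, hr, hδr⟩ := h δ hδ
  have : CompleteSpace W := FiniteDimensional.complete 𝕜 W
  refine ⟨W.subtypeL ∘L extendToClosure e r,
    (isCompactOperator_of_finiteDimensional (extendToClosure e r)).clm_comp W.subtypeL,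
    ContinuousLinearMap.opNorm_le_bound _ hδ.le (norm_apply_le_of_toClosure _ fun v => ?_)⟩
  simpa [extendToClosure_apply hf, extendToClosure_apply hr] using hδr v

theorem IsVanishingSublinear.isCompactOperator (hpos : ∀ n, 0 < Λ n) (hlac : IsLacunary Λ)
    {μ : Measure I} [IsFiniteMeasure μ] (hμ : IsVanishingSublinear μ) {p : ℝ≥0∞}
    [Fact (1 ≤ p)] (hp2 : p ≤ 2) : IsCompactOperator (embedding 𝕜 Λ p μ) := by
  have hp : p ≠ ∞ := ne_top_of_le_ne_top (by norm_num) hp2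
  have hp1 : 1 ≤ p := Fact.out
  have hpr : 0 < p.toReal := ENNReal.toReal_pos (zero_lt_one.trans_le hp1).ne' hp
  have hpr1 : 1 ≤ p.toReal := by simpa using ENNReal.toReal_mono hp hp1
  obtain ⟨C, hC, hmaj⟩ := exists_integral_majorant_le (𝕜 := 𝕜) hpos hlac hp2
  obtain ⟨K, hK, hK'⟩ := hμ.isSublinear.exists_bound
  obtain ⟨C', -, hemb⟩ := hμ.isSublinear.isEmbedding (𝕜 := 𝕜) hpos hlac hp2
  refine isCompactOperator_extendToClosure ⟨C', hemb⟩ fun δ hδ => ?_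
  obtain ⟨N, hN⟩ := hμ.exists_tail_le (𝕜 := 𝕜) hpos hlac hpr1
    (show 0 < δ ^ p.toReal / C by positivity)
  -- The approximating map `head` keeps the terms with index `< N`, so it has values in a
  -- finite-dimensional subspace of `L^p(μ)`.
  let W := Finsupp.supported 𝕜 𝕜 (Set.Iio N)
  have hWfin : FiniteDimensional 𝕜 W :=
    Module.Finite.equiv (Finsupp.supportedEquivFinsupp (M := 𝕜) (R := 𝕜) (Set.Iio N)).symm
  let f : W →ₗ[𝕜] Lp 𝕜 p μ := polynomialLp 𝕜 Λ p μ ∘ₗ W.subtype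
  let head : (ℕ →₀ 𝕜) →ₗ[𝕜] LinearMap.range f :=
    f.rangeRestrict ∘ₗ Finsupp.restrictDom 𝕜 𝕜 (Set.Iio N)
  have hhead : ∀ c, (head c : Lp 𝕜 p μ) = polynomialLp 𝕜 Λ p μ (c.filter fun n => n < N) :=
    fun c => rfl
  have hbound : ∀ c, ‖head c‖ ≤ (K * C) ^ p.toReal⁻¹ * ‖polynomialLp 𝕜 Λ p leb c‖ := by
    intro c
    refine le_rpow_inv_mul_of_rpow_le hpr (norm_nonneg _) (norm_nonneg _)
      (mul_nonneg hK hC.le) ?_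
    rw [← Submodule.norm_coe, hhead]
    calc _ ≤ ∫ x, majorant Λ (c.filter fun n => n < N) x ^ p.toReal ∂μ :=
          norm_polynomialLp_rpow_le hp μ _
      _ ≤ ∫ x, majorant Λ c x ^ p.toReal ∂μ := integral_majorant_filter_le _ c hpr.le μ
      _ ≤ K * ∫ x, majorant Λ c x ^ p.toReal ∂leb :=
          integral_le_of_monotone hK hK' (continuous_majorant_rpow c hpr.le)
            (monotone_majorant_rpow c hpr.le) (majorant_rpow_nonneg c _)
      _ ≤ K * (C * ‖polynomialLp 𝕜 Λ p leb c‖ ^ p.toReal) :=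
          mul_le_mul_of_nonneg_left (hmaj c) hK
      _ = _ := by ring
  refine ⟨LinearMap.range f, inferInstance, head, ⟨_, hbound⟩, fun c => ?_⟩
  have hdiff : polynomialLp 𝕜 Λ p μ c - head c =
      polynomialLp 𝕜 Λ p μ (c.filter fun n => ¬ n < N) := by
    rw [hhead, ← map_sub]
    congr 1
    rw [sub_eq_iff_eq_add']
    exact (Finsupp.filter_add_filter_not c _).symm
  rw [hdiff]
  have h := calc
    ‖polynomialLp 𝕜 Λ p μ (c.filter fun n => ¬ n < N)‖ ^ p.toReal
      ≤ ∫ x, majorant Λ (c.filter fun n => ¬ n < N) x ^ p.toReal ∂μ :=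
        norm_polynomialLp_rpow_le hp μ _
    _ ≤ δ ^ p.toReal / C * ∫ x, majorant Λ c x ^ p.toReal ∂leb := hN c
    _ ≤ δ ^ p.toReal / C * (C * ‖polynomialLp 𝕜 Λ p leb c‖ ^ p.toReal) :=
        mul_le_mul_of_nonneg_left (hmaj c) (by positivity)
    _ = δ ^ p.toReal * ‖polynomialLp 𝕜 Λ p leb c‖ ^ p.toReal := by field_simp
  have h' := le_rpow_inv_mul_of_rpow_le hpr (norm_nonneg _) (norm_nonneg _) (by positivity) h
  rwa [← Real.rpow_mul (by positivity), mul_inv_cancel₀ hpr.ne', Real.rpow_one] at h'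

end

end Muntz

theorem mainTheorem10 (𝕜 : Type*) [RCLike 𝕜] (Λ : ℕ → ℝ≥0) (hpos : ∀ n, 0 < Λ n)
    (hlac : Muntz.IsLacunary Λ) :
    (∀ (μ : Measure I) [IsFiniteMeasure μ], Muntz.IsSublinear μ →
      ∀ (p : ℝ≥0∞) [Fact (1 ≤ p)], p ≤ 2 → Muntz.IsEmbedding 𝕜 Λ p μ) ∧
    (∀ (μ : Measure I) [IsFiniteMeasure μ], Muntz.IsVanishingSublinear μ →
      ∀ (p : ℝ≥0∞) [Fact (1 ≤ p)], p ≤ 2 →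
        Muntz.IsEmbedding 𝕜 Λ p μ ∧ IsCompactOperator (Muntz.embedding 𝕜 Λ p μ)) :=
  ⟨fun _ _ hμ _ _ hp => hμ.isEmbedding hpos hlac hp, fun _ _ hμ _ _ hp =>
    ⟨hμ.isSublinear.isEmbedding hpos hlac hp, hμ.isCompactOperator hpos hlac hp⟩⟩
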